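/- Let $p$ be a prime, let $\psi:\mathbb{Q}_p\to\{w\in\mathbb{C}:|w|=1\}$ be a nontrivial continuous additive character, and let $r\ge 1$. Let $f=(f_1,\ldots,f_r)$ be polynomials in $x=(x_1,\ldots,x_n)$ over $\mathbb{Q}_p$ such that $1,f_1,\ldots,f_r$ are linearly independent over $\mathbb{Q}_p$, and let $d(f)=\max_{i,j}\deg_{x_j}(f_i)$ (so $n\ge1$ and $d(f)\ge 1$). Let $\phi:\mathbb{Q}_p^n\to\mathbb{Q}$ be a Schwartz–Bruhat function, that is, locally constant with compact support. For $y\in\mathbb{Q}_p^r$ put $$E_{\phi,f}(y)=\int_{\mathbb{Q}_p^n}\phi(x)\,\psi(y\cdot f(x))\,|dx|,\qquad y\cdot f(x)=\sum_{i=1}^r y_if_i(x),$$ where $|dx|$ is the Haar measure on $\mathbb{Q}_p^n$ giving $\mathbb{Z}_p^n$ measure $1$; let $v(y)=\min_i v(y_i)$, where $v$ is the $p$-adic valuation with $v(0)=\infty$, and $|y|=\max_i|y_i|=p^{-v(y)}$. Then for every $\varepsilon$ with $0<\varepsilon\le 1/d(f)$ there is a constant $c$ such that $$|E_{\phi,f}(y)|\le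 c\,\min\{|y|^{\varepsilon-1/d(f)},1\}\qquad\text{for all } y\in\mathbb{Q}_p^r,$$ where the minimum is read as $1$ at $y=0$. Moreover, there is a constant $c$ such that $$|E_{\phi,f}(y)|\le c\,(-v(y))^{n-1}|y|^{-1/d(f)}\qquad\text{for all } y\in\mathbb{Q}_p^r\text{ with } v(y)<0.$$ The constants may depend on $p,n,r,\psi,f,\phi$ (and, in the first bound, on $\varepsilon$), but not on $y$. -/

import Mathlib

open MeasureTheory

noncomputable section

namespace PadicExp

variable (p : ℕ) [Fact p.Prime]

instance instMeasurableSpacePadic : MeasurableSpace ℚ_[p] := borel ℚ_[p]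

instance instBorelSpacePadic : BorelSpace ℚ_[p] := ⟨rfl⟩

/-- The ring of integers, as a compact subset of `ℚ_[p]` with nonempty interior. -/
def integersCompacts : TopologicalSpace.PositiveCompacts ℚ_[p] where
  carrier := Metric.closedBall 0 1
  isCompact' := isCompact_closedBall 0 1
  interior_nonempty' := ⟨0, mem_interior.2
    ⟨Metric.ball 0 1, Metric.ball_subset_closedBall, Metric.isOpen_ball, by simp⟩⟩

/-- The Haar measure on `ℚ_[p]` that gives the ring of integers measure `1`. -/
def haar : Measure ℚ_[p] := Measure.addHaarMeasure (integersCompacts p)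

/-- The measure `|dx|` on `ℚ_[p]ⁿ`: the product of the normalized Haar measures. -/
def haarPi (n : ℕ) : Measure (Fin n → ℚ_[p]) := Measure.pi fun _ => haar p

variable {p}

/-- A Schwartz–Bruhat function is locally constant and has compact support. -/
def IsSchwartzBruhat {n : ℕ} (φ : (Fin n → ℚ_[p]) → ℚ) : Prop :=
  IsLocallyConstant φ ∧ HasCompactSupport φ

/-- `d(f)`: the maximum over `i` and `j` of the degree of `f i` in the variable `x_j`. -/
def maxPartialDegree {n r : ℕ} (f : Fin r → MvPolynomial (Fin n) ℚ_[p]) : ℕ :=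
  Finset.univ.sup fun i => Finset.univ.sup fun j => (f i).degreeOf j

/-- The valuation `v(y) = min_i v(y_i)` of a tuple, with `v(0) = ∞`. -/
def tupleValuation {r : ℕ} (y : Fin r → ℚ_[p]) : WithTop ℤ :=
  Finset.univ.inf fun i => Padic.addValuation (y i)

/-- The exponential integral `E_{φ,f}(y) = ∫ φ(x) ψ(y ⬝ f(x)) |dx|`. -/
def expIntegral {n r : ℕ} (ψ : AddChar ℚ_[p] Circle) (φ : (Fin n → ℚ_[p]) → ℚ)
    (f : Fin r → MvPolynomial (Fin n) ℚ_[p]) (y : Fin r → ℚ_[p]) : ℂ :=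
  ∫ x, (φ x : ℂ) * (ψ (y ⬝ᵥ fun i => MvPolynomial.eval x (f i)) : ℂ) ∂(haarPi p n)

end PadicExp

end

noncomputable section

namespace PadicExp

section Polynomial

open Polynomial

/-! Linear independence of `1, f_1, …, f_r` makes `y ↦` (nonconstant coefficients of `y ⬝ f`)
injective on a finite-dimensional space, so some coefficient `c_e` with `e ≠ 0` satisfies `|y| ≤ B
|c_e|` (`exists_le_norm_coeff`). Pick a variable `x_i` with `k = e_i ≥ 1` and integrate over it
first, the others being parameters.

In one variable (`norm_integral_mul_addChar_le`), delete the points within `ρ` of a root of `g'`;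
their measure is at most `d ρ`. Elsewhere `|g'|` is constant on balls of radius `ρ`, and `g` is
linear up to an error invisible to `ψ` on smaller balls, where `ψ ∘ g` integrates to zero. This
works down to `ρ` of order `|g_k|^(-1/d)`, so the integral is `O(max(1, |g_k|)^(-1/d))`, uniformly
in `g` of degree at most `d`.

The coefficient `g_k` is itself a polynomial in the other `n - 1` variables, with `c_e` among its
coefficients. Averaging the weight `|g_k|^(-1/d)`, truncated at `|y| = p^L`, over one variable
replaces `g_k` by one of its coefficients at the cost of a factor `O(L + 1)`
(`integral_decayWeight_le`): the `L` shells around the roots contribute equally. Repeating this `n -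
1` times gives `L^(n-1) |y|^(-1/d)`, and the power of `L` is absorbed by `|y|^ε`. -/

/-! ### Haar measure of p-adic balls -/

instance instIsAddHaarMeasureHaar (p : ℕ) [Fact p.Prime] : (haar p).IsAddHaarMeasure := by
  unfold haar; infer_instance

lemma haar_closedBall_zero_one (p : ℕ) [Fact p.Prime] :
    haar p (Metric.closedBall 0 1) = 1 :=
  Measure.addHaarMeasure_self (K₀ := integersCompacts p)

variable {p : ℕ} [Fact p.Prime]

lemma norm_sub_le_norm_max {E : Type*} [SeminormedAddCommGroup E] [IsUltrametricDist E]
    (x y : E) :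
    ‖x - y‖ ≤ max ‖x‖ ‖y‖ := by
  rw [sub_eq_add_neg, ← norm_neg y]
  exact IsUltrametricDist.norm_add_le_max _ _

/-- The balls centred at `0, …, p^j - 1` are disjoint translates of one another inside the unit
ball, which has measure `1`. -/
lemma haar_closedBall_le (x : ℚ_[p]) (j : ℕ) :
    (haar p).real (Metric.closedBall x ((p : ℝ) ^ j)⁻¹) ≤ ((p : ℝ) ^ j)⁻¹ := by
  have hp : (0 : ℝ) < p := by exact_mod_cast (Fact.out : p.Prime).pos
  have hp1 : (1 : ℝ) ≤ p := by exact_mod_cast (Fact.out : p.Prime).one_le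
  set ρ : ℝ := ((p : ℝ) ^ j)⁻¹ with hρ
  have hρ1 : ρ ≤ 1 := inv_le_one_of_one_le₀ (one_le_pow₀ hp1)
  have htrans : ∀ y : ℚ_[p], (haar p).real (Metric.closedBall y ρ) =
      (haar p).real (Metric.closedBall x ρ) := by
    intro y
    have h : Metric.closedBall y ρ = (fun z => (x - y) + z) ⁻¹' Metric.closedBall x ρ := by
      ext z
      simp only [Metric.mem_closedBall, Set.mem_preimage, dist_eq_norm]
      rw [show x - y + z - x = z - y by ring]
    rw [h, measureReal_def, measure_preimage_add, measureReal_def]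
  have hdisj : Set.PairwiseDisjoint (↑(Finset.range (p ^ j)) : Set ℕ)
      (fun k : ℕ => Metric.closedBall (k : ℚ_[p]) ρ) := by
    intro k hk l hl hkl
    simp only [Finset.coe_range, Set.mem_Iio] at hk hl
    rw [Function.onFun, Set.disjoint_left]
    intro z hz hz'
    simp only [Metric.mem_closedBall, dist_eq_norm] at hz hz'
    have h : ‖(((k : ℤ) - (l : ℤ) : ℤ) : ℚ_[p])‖ ≤ (p : ℝ) ^ (-(j : ℤ)) := by
      rw [zpow_neg, zpow_natCast]
      push_cast
      have e : (k : ℚ_[p]) - l = (z - l) - (z - k) := by ring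
      rw [e]
      exact (norm_sub_le_norm_max _ _).trans (max_le hz' hz)
    rw [Padic.norm_int_le_pow_iff_dvd] at h
    apply hkl
    have h2 := Int.eq_zero_of_abs_lt_dvd h (by
      have hk' : (k : ℤ) < (p : ℤ) ^ j := by exact_mod_cast hk
      have hl' : (l : ℤ) < (p : ℤ) ^ j := by exact_mod_cast hl
      rw [abs_lt]; constructor <;> omega)
    omega
  have hsub : (⋃ k ∈ Finset.range (p ^ j), Metric.closedBall (k : ℚ_[p]) ρ) ⊆
      Metric.closedBall 0 1 := by
    intro z hz
    simp only [Set.mem_iUnion, exists_prop] at hz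
    obtain ⟨k, -, hk⟩ := hz
    simp only [Metric.mem_closedBall, dist_eq_norm, sub_zero] at hk ⊢
    rw [show z = (z - k) + k by ring]
    refine (IsUltrametricDist.norm_add_le_max _ _).trans (max_le (hk.trans hρ1) ?_)
    exact_mod_cast Padic.norm_int_le_one (p := p) (k : ℤ)
  have hle := measureReal_mono (μ := haar p) hsub
    (by rw [haar_closedBall_zero_one]; exact ENNReal.one_ne_top)
  rw [measureReal_biUnion_finset hdisj (fun _ _ => Metric.isClosed_closedBall.measurableSet)
    (fun _ _ => (isCompact_closedBall _ _).measure_lt_top.ne), measureReal_def (haar p)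
      (Metric.closedBall 0 1), haar_closedBall_zero_one] at hle
  simp only [htrans, Finset.sum_const, Finset.card_range, nsmul_eq_mul, ENNReal.toReal_one,
    Nat.cast_pow] at hle
  exact ((le_div_iff₀' (pow_pos hp j)).2 hle).trans_eq (one_div _)

/-! ### Neighbourhoods of the roots of a polynomial -/

/-- The points at distance at most `ρ` from a root of `q` in the algebraic closure. -/
def nearRoots (q : ℚ_[p][X]) (ρ : ℝ) : Set ℚ_[p] :=
  {x | ∃ z ∈ (q.map (algebraMap ℚ_[p] (PadicAlgCl p))).roots,
    ‖algebraMap ℚ_[p] (PadicAlgCl p) x - z‖ ≤ ρ}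

lemma mem_nearRoots_of_norm_sub_le {q : ℚ_[p][X]} {ρ : ℝ} {x y : ℚ_[p]}
    (hx : x ∈ nearRoots q ρ) (hxy : ‖y - x‖ ≤ ρ) : y ∈ nearRoots q ρ := by
  obtain ⟨z, hz, h⟩ := hx
  refine ⟨z, hz, ?_⟩
  rw [show algebraMap ℚ_[p] (PadicAlgCl p) y - z =
    algebraMap ℚ_[p] (PadicAlgCl p) (y - x) + (algebraMap ℚ_[p] (PadicAlgCl p) x - z) by
      rw [map_sub]; ring]
  refine (IsUltrametricDist.norm_add_le_max _ _).trans (max_le ?_ h)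
  rwa [norm_algebraMap']

lemma add_mem_nearRoots_iff {q : ℚ_[p][X]} {ρ : ℝ} {x s : ℚ_[p]} (hs : ‖s‖ ≤ ρ) :
    x + s ∈ nearRoots q ρ ↔ x ∈ nearRoots q ρ :=
  ⟨fun h => mem_nearRoots_of_norm_sub_le h (by simpa using hs),
    fun h => mem_nearRoots_of_norm_sub_le h (by simpa using hs)⟩

lemma isClopen_nearRoots (q : ℚ_[p][X]) {ρ : ℝ} (hρ : 0 < ρ) : IsClopen (nearRoots q ρ) := by
  have key : ∀ x y : ℚ_[p], y ∈ Metric.ball x ρ → ‖y - x‖ ≤ ρ := fun x y hy => by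
    rw [← dist_eq_norm]; exact (Metric.mem_ball.1 hy).le
  constructor
  · rw [← isOpen_compl_iff, Metric.isOpen_iff]
    refine fun x hx => ⟨ρ, hρ, fun y hy hy' => hx (mem_nearRoots_of_norm_sub_le hy' ?_)⟩
    rw [norm_sub_rev]; exact key x y hy
  · rw [Metric.isOpen_iff]
    exact fun x hx => ⟨ρ, hρ, fun y hy => mem_nearRoots_of_norm_sub_le hx (key x y hy)⟩

/-- A root `z` need not lie in `ℚ_[p]`, but by the ultrametric inequality the points of `ℚ_[p]`
within `ρ` of `z` lie in a single ball of radius `ρ` with centre in `ℚ_[p]`. There are at most `D`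
roots. -/
lemma haar_nearRoots_le {q : ℚ_[p][X]} {D : ℕ} (hq : q.natDegree ≤ D) (j : ℕ) :
    (haar p).real (nearRoots q ((p : ℝ) ^ j)⁻¹) ≤ D * ((p : ℝ) ^ j)⁻¹ ∧
      haar p (nearRoots q ((p : ℝ) ^ j)⁻¹) ≠ ⊤ := by
  classical
  set ρ : ℝ := ((p : ℝ) ^ j)⁻¹ with hρ
  have hρ0 : 0 ≤ ρ := by positivity
  set Z := (q.map (algebraMap ℚ_[p] (PadicAlgCl p))).roots with hZ
  have hball : ∀ z : PadicAlgCl p, ∃ x : ℚ_[p],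
      {y | ‖algebraMap ℚ_[p] (PadicAlgCl p) y - z‖ ≤ ρ} ⊆ Metric.closedBall x ρ := by
    intro z
    by_cases h : ∃ x, ‖algebraMap ℚ_[p] (PadicAlgCl p) x - z‖ ≤ ρ
    · obtain ⟨x, hx⟩ := h
      refine ⟨x, fun y hy => ?_⟩
      rw [Metric.mem_closedBall, dist_eq_norm, ← norm_algebraMap' (PadicAlgCl p), map_sub,
        ← sub_sub_sub_cancel_right _ _ z]
      exact (norm_sub_le_norm_max _ _).trans (max_le hy hx)
    · exact ⟨0, fun y hy => (h ⟨y, hy⟩).elim⟩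
  choose c hc using hball
  have hsub : nearRoots q ρ ⊆ ⋃ z ∈ Z.toFinset, Metric.closedBall (c z) ρ := by
    rintro x ⟨z, hz, h⟩
    simp only [Set.mem_iUnion]
    exact ⟨z, Multiset.mem_toFinset.2 hz, hc z h⟩
  have hfin : haar p (⋃ z ∈ Z.toFinset, Metric.closedBall (c z) ρ) ≠ ⊤ :=
    (measure_biUnion_lt_top Z.toFinset.finite_toSet
      fun _ _ => (isCompact_closedBall _ _).measure_lt_top).ne
  refine ⟨?_, ne_top_of_le_ne_top hfin (measure_mono hsub)⟩
  calc (haar p).real (nearRoots q ρ)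
      ≤ (haar p).real (⋃ z ∈ Z.toFinset, Metric.closedBall (c z) ρ) := measureReal_mono hsub hfin
    _ ≤ ∑ z ∈ Z.toFinset, (haar p).real (Metric.closedBall (c z) ρ) :=
        measureReal_biUnion_finset_le _ _
    _ ≤ ∑ z ∈ Z.toFinset, ρ := Finset.sum_le_sum fun z _ => haar_closedBall_le _ _
    _ = Z.toFinset.card * ρ := by simp
    _ ≤ D * ρ := by
        gcongr
        exact (Multiset.toFinset_card_le _).trans ((card_roots' _).trans
          (natDegree_map_le.trans hq))

/-! ### Taylor expansion away from the roots -/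

/-- At radius `ρ` the constant term of the polynomial has the largest norm. -/
def ConstDominates {K : Type*} [NormedField K] (ρ : ℝ) (q : K[X]) : Prop :=
  ∀ i, ‖q.coeff i‖ * ρ ^ i ≤ ‖q.coeff 0‖

lemma ConstDominates.mul {K : Type*} [NormedField K] [IsUltrametricDist K] {ρ : ℝ} (hρ : 0 ≤ ρ)
    {q r : K[X]} (hq : ConstDominates ρ q) (hr : ConstDominates ρ r) :
    ConstDominates ρ (q * r) := by
  intro i
  rw [mul_coeff_zero, norm_mul, coeff_mul]
  rcases hρ.eq_or_lt with rfl | hρ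
  · rcases Nat.eq_zero_or_pos i with rfl | hi
    · simp
    · rw [zero_pow hi.ne', mul_zero]; positivity
  rw [← le_div_iff₀ (by positivity)]
  refine IsUltrametricDist.norm_sum_le_of_forall_le_of_nonneg (by positivity) fun x hx => ?_
  rw [le_div_iff₀ (by positivity), ← Finset.HasAntidiagonal.mem_antidiagonal.1 hx, pow_add, norm_mul]
  calc ‖q.coeff x.1‖ * ‖r.coeff x.2‖ * (ρ ^ x.1 * ρ ^ x.2)
      = (‖q.coeff x.1‖ * ρ ^ x.1) * (‖r.coeff x.2‖ * ρ ^ x.2) := by ring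
    _ ≤ _ := mul_le_mul (hq _) (hr _) (by positivity) (by positivity)

lemma constDominates_C {K : Type*} [NormedField K] (ρ : ℝ) (a : K) :
    ConstDominates ρ (C a) := by
  intro i
  rcases Nat.eq_zero_or_pos i with rfl | hi
  · simp
  · simp [coeff_C, hi.ne']

lemma constDominates_X_add_C {K : Type*} [NormedField K] {ρ : ℝ} {a : K} (h : ρ ≤ ‖a‖) :
    ConstDominates ρ (X + C a) := by
  intro i
  match i with
  | 0 => simp
  | 1 => simpa [coeff_C] using h
  | i + 2 => simp [coeff_X, coeff_C]

/-- Over the algebraic closure the Taylor polynomial at `x` is a constant times the product of the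
factors `X + (x - z)`. Each has dominant constant term because `|x - z| ≥ ρ`, and dominance is
multiplicative. -/
lemma constDominates_taylor {q : ℚ_[p][X]} {ρ : ℝ} (hρ : 0 ≤ ρ) {x : ℚ_[p]}
    (hx : x ∉ nearRoots q ρ) : ConstDominates ρ (taylor x q) := by
  have key : ConstDominates ρ ((taylor x q).map (algebraMap ℚ_[p] (PadicAlgCl p))) := by
    have hall : ∀ z ∈ (q.map (algebraMap ℚ_[p] (PadicAlgCl p))).roots,
        ρ ≤ ‖algebraMap ℚ_[p] (PadicAlgCl p) x - z‖ := fun z hz => by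
      by_contra! h
      exact hx ⟨z, hz, h.le⟩
    rw [map_taylor, (IsAlgClosed.splits (q.map (algebraMap ℚ_[p] (PadicAlgCl p)))).eq_prod_roots,
      taylor_mul, taylor_C]
    refine (constDominates_C _ _).mul hρ ?_
    generalize (q.map (algebraMap ℚ_[p] (PadicAlgCl p))).roots = Z at hall
    induction Z using Multiset.induction with
    | empty => simpa using constDominates_C ρ (1 : PadicAlgCl p)
    | cons z Z ih =>
      rw [Multiset.map_cons, Multiset.prod_cons, taylor_mul]
      refine ConstDominates.mul hρ ?_ (ih fun w hw => hall w (Multiset.mem_cons_of_mem hw))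
      rw [map_sub, taylor_X, taylor_C, add_sub_assoc, ← C_sub]
      exact constDominates_X_add_C (hall z (Multiset.mem_cons_self _ _))
  intro i
  have := key i
  rwa [coeff_map, coeff_map, norm_algebraMap', norm_algebraMap'] at this

lemma norm_eval_le_of_norm_sub_le {q : ℚ_[p][X]} {ρ : ℝ} (hρ : 0 ≤ ρ) {x y : ℚ_[p]}
    (hx : x ∉ nearRoots q ρ) (hxy : ‖y - x‖ ≤ ρ) : ‖q.eval y‖ ≤ ‖q.eval x‖ := by
  rw [← taylor_eval_sub (r := x) q y, eval_eq_sum_range]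
  refine IsUltrametricDist.norm_sum_le_of_forall_le_of_nonneg (norm_nonneg _) fun i _ => ?_
  rw [norm_mul, norm_pow, ← taylor_coeff_zero]
  exact le_trans (by gcongr) (constDominates_taylor hρ hx i)

lemma norm_eval_eq_of_norm_sub_le {q : ℚ_[p][X]} {ρ : ℝ} (hρ : 0 ≤ ρ) {x y : ℚ_[p]}
    (hx : x ∉ nearRoots q ρ) (hxy : ‖y - x‖ ≤ ρ) : ‖q.eval y‖ = ‖q.eval x‖ := by
  refine le_antisymm (norm_eval_le_of_norm_sub_le hρ hx hxy)
    (norm_eval_le_of_norm_sub_le hρ (fun hy => hx ?_) ?_)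
  · exact mem_nearRoots_of_norm_sub_le hy (by rwa [norm_sub_rev])
  · rwa [norm_sub_rev]

/-- The Taylor coefficients at `x` are controlled by `|q(x)|`; re-expanding at `0` costs only powers
of `|x| ≤ R`, since binomial coefficients are p-adic integers. -/
lemma norm_coeff_le {q : ℚ_[p][X]} {D : ℕ} (hq : q.natDegree ≤ D) {ρ R : ℝ} (hρ : 0 < ρ)
    (hρ1 : ρ ≤ 1) (hR : 1 ≤ R) {x : ℚ_[p]} (hxR : ‖x‖ ≤ R) (hx : x ∉ nearRoots q ρ) (k : ℕ) :
    ‖q.coeff k‖ * ρ ^ D ≤ R ^ D * ‖q.eval x‖ := by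
  have hdom := constDominates_taylor hρ.le hx
  have h1 : q = taylor (-x) (taylor x q) := by rw [taylor_taylor]; simp
  have h2 : taylor x q = ∑ i ∈ Finset.range (D + 1), monomial i ((taylor x q).coeff i) :=
    as_sum_range' _ _ (by rw [natDegree_taylor]; omega)
  rw [← le_div_iff₀ (by positivity)]
  conv_lhs => rw [h1, h2, map_sum, finsetSum_coeff]
  refine IsUltrametricDist.norm_sum_le_of_forall_le_of_nonneg (by positivity) fun i hi => ?_
  have hi' : i ≤ D := by have := Finset.mem_range.1 hi; omega
  rw [taylor_monomial, coeff_C_mul, coeff_X_add_C_pow, norm_mul, norm_mul, norm_pow, norm_neg,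
    le_div_iff₀ (by positivity)]
  have hc : ‖((i.choose k : ℕ) : ℚ_[p])‖ ≤ 1 := by
    exact_mod_cast Padic.norm_int_le_one (p := p) (i.choose k : ℤ)
  have hd := hdom i
  rw [taylor_coeff_zero] at hd
  calc ‖(taylor x q).coeff i‖ * (‖x‖ ^ (i - k) * ‖((i.choose k : ℕ) : ℚ_[p])‖) * ρ ^ D
      ≤ ‖(taylor x q).coeff i‖ * (R ^ D * 1) * ρ ^ i := by
        have e1 : ‖x‖ ^ (i - k) ≤ R ^ D :=
          (pow_le_pow_left₀ (norm_nonneg _) hxR _).trans (pow_le_pow_right₀ hR (by omega))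
        have e2 : ρ ^ D ≤ ρ ^ i := pow_le_pow_of_le_one hρ.le hρ1 hi'
        gcongr
    _ = R ^ D * (‖(taylor x q).coeff i‖ * ρ ^ i) := by ring
    _ ≤ _ := by gcongr

/-! ### The truncated decay weight -/

/-- The decreasing weight `t ↦ t ^ (-1 / d)`, truncated to be constant for `t ≤ 1` and for
`t ≥ p ^ L`. -/
def decayWeight (p d L : ℕ) (t : ℝ) : ℝ := (max 1 (min t ((p : ℝ) ^ L))) ^ (-(1 / (d : ℝ)))

lemma decayWeight_pos (p d L : ℕ) (t : ℝ) : 0 < decayWeight p d L t :=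
  Real.rpow_pos_of_pos (lt_max_of_lt_left one_pos) _

lemma decayWeight_le_one (p d L : ℕ) (t : ℝ) : decayWeight p d L t ≤ 1 :=
  Real.rpow_le_one_of_one_le_of_nonpos (le_max_left _ _) (by simp)

lemma continuous_decayWeight (p d L : ℕ) : Continuous (decayWeight p d L) :=
  Continuous.rpow_const (by fun_prop) fun _ => Or.inl (lt_max_of_lt_left one_pos).ne'

lemma rpow_neg_le_decayWeight (p d L : ℕ) (t : ℝ) :
    (max 1 t) ^ (-(1 / (d : ℝ))) ≤ decayWeight p d L t :=
  Real.rpow_le_rpow_of_nonpos (lt_max_of_lt_left one_pos)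
    (max_le_max_left _ (min_le_left _ _)) (by simp)

lemma decayWeight_le_mul {p d L : ℕ} (hd : d ≠ 0) {A s t : ℝ} (hA : 1 ≤ A) (h : s ≤ A ^ d * t) :
    decayWeight p d L t ≤ A * decayWeight p d L s := by
  have hA' : 1 ≤ A ^ d := one_le_pow₀ hA
  have key : max 1 (min s ((p : ℝ) ^ L)) ≤ A ^ d * max 1 (min t ((p : ℝ) ^ L)) := by
    rw [mul_max_of_nonneg _ _ (by positivity), mul_min_of_nonneg _ _ (by positivity)]
    refine max_le_max (by simpa using hA') (min_le_min h ?_)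
    exact le_mul_of_one_le_left (by positivity) hA'
  have h1 := Real.rpow_le_rpow_of_nonpos (z := -(1 / (d : ℝ)))
    (lt_max_of_lt_left one_pos) key (by simp)
  rw [Real.mul_rpow (by positivity) (by positivity), Real.rpow_neg (by positivity) (1 / (d : ℝ)),
    one_div, Real.pow_rpow_inv_natCast (by positivity) hd,
    inv_mul_le_iff₀ (by positivity)] at h1
  simpa only [decayWeight, one_div] using h1

/-- The purpose of the truncation: a set of measure `O(p^(-L))` is negligible against any value of
the weight, so only `L` shells around the roots need be examined. -/
lemma inv_pow_le_decayWeight {p d L : ℕ} (hp : 1 ≤ p) (hd : d ≠ 0) (t : ℝ) :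
    ((p : ℝ) ^ L)⁻¹ ≤ decayWeight p d L t := by
  have hp' : (1 : ℝ) ≤ (p : ℝ) ^ L := one_le_pow₀ (by exact_mod_cast hp)
  have hd' : (1 : ℝ) ≤ d := by exact_mod_cast Nat.one_le_iff_ne_zero.2 hd
  rw [← Real.rpow_neg_one]
  calc ((p : ℝ) ^ L) ^ (-1 : ℝ) ≤ ((p : ℝ) ^ L) ^ (-(1 / (d : ℝ))) := by
        apply Real.rpow_le_rpow_of_exponent_le hp'
        rw [neg_le_neg_iff, div_le_one (by positivity)]; exact hd'
    _ ≤ _ := Real.rpow_le_rpow_of_nonpos (lt_max_of_lt_left one_pos)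
        (max_le hp' (min_le_right _ _)) (by simp)

lemma inv_le_rpow_neg {d : ℕ} (hd : d ≠ 0) {B t : ℝ} (hB : 1 ≤ B) (h : t ≤ B ^ d) :
    B⁻¹ ≤ (max 1 t) ^ (-(1 / (d : ℝ))) := by
  have h1 := Real.rpow_le_rpow_of_nonpos (z := -(1 / (d : ℝ)))
    (lt_max_of_lt_left one_pos) (max_le (one_le_pow₀ hB) h) (by simp)
  rwa [Real.rpow_neg (by positivity), one_div, Real.pow_rpow_inv_natCast (by positivity) hd,
    ← one_div (d : ℝ)] at h1

/-! ### Sublevel estimate in one variable -/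

/-- The restriction of the Haar measure to the ball of radius `R`. -/
def haarBall (p : ℕ) [Fact p.Prime] (R : ℝ) : Measure ℚ_[p] :=
  (haar p).restrict (Metric.closedBall 0 R)

instance instIsFiniteMeasureHaarBall (R : ℝ) : IsFiniteMeasure (haarBall p R) :=
  ⟨by rw [haarBall, Measure.restrict_apply_univ]; exact (isCompact_closedBall _ _).measure_lt_top⟩

/-- Shell decomposition: a point within `p^(-j)` of the roots but not within `p^(-(j+1))` has `|q_k|
≤ (R p^(j+1))^d |q(x)|` by `norm_coeff_le`, so its weight grows by at most `R p^(j+1)`. In the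
innermost neighbourhood the weight is bounded by `1`. -/
lemma decayWeight_eval_le {q : ℚ_[p][X]} {d : ℕ} (hd : d ≠ 0) (hq : q.natDegree ≤ d) {R : ℝ}
    (hR : 1 ≤ R) {x : ℚ_[p]} (hx : ‖x‖ ≤ R) (k L N : ℕ) :
    decayWeight p d L ‖q.eval x‖ ≤ R * decayWeight p d L ‖q.coeff k‖ +
      ∑ j ∈ Finset.range N, (nearRoots q ((p : ℝ) ^ j)⁻¹).indicator
        (fun _ => R * (p : ℝ) ^ (j + 1) * decayWeight p d L ‖q.coeff k‖) x +
      (nearRoots q ((p : ℝ) ^ N)⁻¹).indicator (fun _ => 1) x := by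
  have hp1 : (1 : ℝ) ≤ p := by exact_mod_cast (Fact.out : p.Prime).one_le
  have hw := decayWeight_pos p d L ‖q.coeff k‖
  have hgood : ∀ j : ℕ, x ∉ nearRoots q ((p : ℝ) ^ j)⁻¹ → decayWeight p d L ‖q.eval x‖ ≤
      R * (p : ℝ) ^ j * decayWeight p d L ‖q.coeff k‖ := by
    intro j hj
    have hpj : (1 : ℝ) ≤ (p : ℝ) ^ j := one_le_pow₀ hp1
    refine decayWeight_le_mul hd (one_le_mul_of_one_le_of_one_le hR hpj) ?_
    have := norm_coeff_le hq (by positivity) (inv_le_one_of_one_le₀ hpj) hR hx hj k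
    rw [inv_pow, ← div_eq_mul_inv, div_le_iff₀ (by positivity)] at this
    rw [mul_pow]; linarith
  have hterm : ∀ j : ℕ, 0 ≤ (nearRoots q ((p : ℝ) ^ j)⁻¹).indicator
      (fun _ => R * (p : ℝ) ^ (j + 1) * decayWeight p d L ‖q.coeff k‖) x := fun j =>
    Set.indicator_nonneg (fun _ _ => by positivity) _
  induction N with
  | zero =>
    by_cases h : x ∈ nearRoots q ((p : ℝ) ^ 0)⁻¹
    · rw [Set.indicator_of_mem h]
      have := decayWeight_le_one p d L ‖q.eval x‖
      have : 0 ≤ R * decayWeight p d L ‖q.coeff k‖ := by positivity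
      simp only [Finset.range_zero, Finset.sum_empty]; linarith
    · have := hgood 0 h
      rw [Set.indicator_of_notMem h]
      simpa using this
  | succ N ih =>
    have hsum := Finset.sum_nonneg fun j (_ : j ∈ Finset.range N) => hterm j
    have h0 : 0 ≤ R * decayWeight p d L ‖q.coeff k‖ := by positivity
    rw [Finset.sum_range_succ]
    by_cases h1 : x ∈ nearRoots q ((p : ℝ) ^ (N + 1))⁻¹
    · rw [Set.indicator_of_mem h1]
      have := decayWeight_le_one p d L ‖q.eval x‖
      linarith [hterm N]
    · rw [Set.indicator_of_notMem h1]
      by_cases h2 : x ∈ nearRoots q ((p : ℝ) ^ N)⁻¹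
      · rw [Set.indicator_of_mem h2]
        linarith [hgood _ h1]
      · rw [Set.indicator_of_notMem h2] at ih ⊢
        linarith

lemma haarBall_real_nearRoots_le {q : ℚ_[p][X]} {d : ℕ} (hq : q.natDegree ≤ d) (R : ℝ) (j : ℕ) :
    (haarBall p R).real (nearRoots q ((p : ℝ) ^ j)⁻¹) ≤ d * ((p : ℝ) ^ j)⁻¹ := by
  obtain ⟨h, hfin⟩ := haar_nearRoots_le hq j
  refine le_trans ?_ h
  exact ENNReal.toReal_mono hfin (Measure.restrict_apply_le _ _)

/-- Weighted sublevel estimate in one variable. -/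
lemma integral_decayWeight_le {d : ℕ} (hd : d ≠ 0) {R : ℝ} (hR : 1 ≤ R) :
    ∃ C : ℝ, 0 ≤ C ∧ ∀ q : ℚ_[p][X], q.natDegree ≤ d → ∀ k L : ℕ,
      ∫ x, decayWeight p d L ‖q.eval x‖ ∂(haarBall p R) ≤
        C * (L + 1) * decayWeight p d L ‖q.coeff k‖ := by
  have hp1 : (1 : ℝ) ≤ p := by exact_mod_cast (Fact.out : p.Prime).one_le
  refine ⟨R * (haarBall p R).real Set.univ + R * p * d + d, by positivity, fun q hq k L => ?_⟩
  set w := decayWeight p d L ‖q.coeff k‖ with hw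
  have hw0 : 0 < w := decayWeight_pos _ _ _ _
  have hmeas : ∀ j : ℕ, MeasurableSet (nearRoots q ((p : ℝ) ^ j)⁻¹) := fun j =>
    (isClopen_nearRoots q (by positivity)).isOpen.measurableSet
  have hint : ∀ (j : ℕ) (c : ℝ), Integrable ((nearRoots q ((p : ℝ) ^ j)⁻¹).indicator
      (fun _ => c)) (haarBall p R) := fun j c => (integrable_const c).indicator (hmeas j)
  have hL : ((p : ℝ) ^ L)⁻¹ ≤ w :=
    inv_pow_le_decayWeight (Fact.out : p.Prime).one_le hd _
  calc ∫ x, decayWeight p d L ‖q.eval x‖ ∂(haarBall p R)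
      ≤ ∫ x, (R * w + ∑ j ∈ Finset.range L, (nearRoots q ((p : ℝ) ^ j)⁻¹).indicator
          (fun _ => R * (p : ℝ) ^ (j + 1) * w) x +
          (nearRoots q ((p : ℝ) ^ L)⁻¹).indicator (fun _ => 1) x) ∂(haarBall p R) := by
        refine integral_mono_of_nonneg (.of_forall fun x => (decayWeight_pos _ _ _ _).le)
          (((integrable_const _).add (integrable_finsetSum _ fun j _ => hint j _)).add
            (hint L _)) ?_
        filter_upwards [ae_restrict_mem Metric.isClosed_closedBall.measurableSet] with x hx
        exact decayWeight_eval_le hd hq hR (by simpa using hx) k L L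
    _ = R * w * (haarBall p R).real Set.univ + ∑ j ∈ Finset.range L,
          (haarBall p R).real (nearRoots q ((p : ℝ) ^ j)⁻¹) * (R * (p : ℝ) ^ (j + 1) * w) +
          (haarBall p R).real (nearRoots q ((p : ℝ) ^ L)⁻¹) := by
        rw [integral_add, integral_add, integral_finsetSum]
        · simp only [integral_const, integral_indicator_const _ (hmeas _), smul_eq_mul, mul_one]
          ring
        · exact fun j _ => hint j _
        · exact integrable_const _
        · exact integrable_finsetSum _ fun j _ => hint j _
        · exact (integrable_const _).add (integrable_finsetSum _ fun j _ => hint j _)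
        · exact hint L _
    _ ≤ R * w * (haarBall p R).real Set.univ + ∑ j ∈ Finset.range L, R * p * d * w + d * w := by
        refine add_le_add (add_le_add le_rfl (Finset.sum_le_sum fun j _ => ?_)) ?_
        -- The measure `d p^(-j)` of the shell cancels the growth `p^(j+1)` of the weight, so the
        -- bound does not depend on `j`.
        · calc _ ≤ d * ((p : ℝ) ^ j)⁻¹ * (R * (p : ℝ) ^ (j + 1) * w) := by
                gcongr; exact haarBall_real_nearRoots_le hq R j
            _ = R * p * d * w := by rw [pow_succ]; field_simp
        · exact (haarBall_real_nearRoots_le hq R L).trans (by gcongr)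
    _ ≤ _ := by
        rw [Finset.sum_const, Finset.card_range, nsmul_eq_mul]
        have h1 : 0 ≤ R * (haarBall p R).real Set.univ * w * L := by positivity
        have h2 : 0 ≤ R * p * d * w := by positivity
        have h3 : 0 ≤ d * w * L := by positivity
        nlinarith

/-! ### Vanishing of oscillating integrals -/

/-- The local averages form the convolution of `F` with the indicator of a ball, and the integral of
a convolution is the product of the integrals. -/
lemma integral_eq_zero_of_forall_setIntegral {F : ℚ_[p] → ℂ} (hF : Integrable F (haar p)) {σ : ℝ}
    (hσ : 0 < σ) (h : ∀ x, ∫ u in Metric.closedBall 0 σ, F (x - u) ∂(haar p) = 0) :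
    ∫ x, F x ∂(haar p) = 0 := by
  have hS : MeasurableSet (Metric.closedBall (0 : ℚ_[p]) σ) :=
    Metric.isClosed_closedBall.measurableSet
  have hfin : haar p (Metric.closedBall 0 σ) ≠ ⊤ := (isCompact_closedBall _ _).measure_lt_top.ne
  have hint : Integrable ((Metric.closedBall (0 : ℚ_[p]) σ).indicator fun _ => (1 : ℂ))
      (haar p) := (integrable_indicator_iff hS).2 (integrableOn_const hfin)
  have hconv := integral_convolution (ContinuousLinearMap.mul ℂ ℂ) hint hF
  have h0 : ∀ x, convolution ((Metric.closedBall (0 : ℚ_[p]) σ).indicator fun _ => (1 : ℂ)) F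
      (ContinuousLinearMap.mul ℂ ℂ) (haar p) x = 0 := by
    intro x
    rw [convolution, ← h x, ← integral_indicator hS]
    congr 1; ext u
    by_cases hu : u ∈ Metric.closedBall (0 : ℚ_[p]) σ <;> simp [hu]
  simp only [h0, integral_zero, ContinuousLinearMap.mul_apply'] at hconv
  rw [integral_indicator_const _ hS] at hconv
  have hpos : 0 < (haar p).real (Metric.closedBall 0 σ) :=
    ENNReal.toReal_pos (Metric.measure_closedBall_pos _ _ hσ).ne' hfin
  rcases mul_eq_zero.1 hconv.symm with h1 | h1
  · simp [hpos.ne'] at h1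
  · exact h1

/-- Translation by `u₀` preserves the ball and multiplies the integral by `ψ (b * u₀) ≠ 1`. -/
lemma setIntegral_addChar_eq_zero {ψ : AddChar ℚ_[p] Circle} {b u₀ : ℚ_[p]} {σ : ℝ}
    (hu₀ : ‖u₀‖ ≤ σ) (h : ψ (b * u₀) ≠ 1) :
    ∫ u in Metric.closedBall 0 σ, (ψ (b * u) : ℂ) ∂(haar p) = 0 := by
  have hS : MeasurableSet (Metric.closedBall (0 : ℚ_[p]) σ) :=
    Metric.isClosed_closedBall.measurableSet
  have hshift : ∫ u in Metric.closedBall 0 σ, (ψ (b * u) : ℂ) ∂(haar p) =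
      (ψ (b * u₀) : ℂ) * ∫ u in Metric.closedBall 0 σ, (ψ (b * u) : ℂ) ∂(haar p) := by
    conv_lhs => rw [← integral_indicator hS, ← integral_add_left_eq_self _ u₀]
    rw [← integral_indicator hS, ← integral_const_mul]
    congr 1; ext u
    have hiff : u₀ + u ∈ Metric.closedBall (0 : ℚ_[p]) σ ↔
        u ∈ Metric.closedBall (0 : ℚ_[p]) σ := by
      simp only [mem_closedBall_zero_iff]
      refine ⟨fun hu => ?_, fun hu => (IsUltrametricDist.norm_add_le_max _ _).trans
        (max_le hu₀ hu)⟩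
      rw [← add_sub_cancel_left u₀ u]
      exact (norm_sub_le_norm_max _ _).trans (max_le hu hu₀)
    by_cases hu : u ∈ Metric.closedBall (0 : ℚ_[p]) σ
    · rw [Set.indicator_of_mem hu, Set.indicator_of_mem (hiff.2 hu), mul_add,
        AddChar.map_add_eq_mul, Circle.coe_mul]
    · rw [Set.indicator_of_notMem hu, Set.indicator_of_notMem (fun h => hu (hiff.1 h)), mul_zero]
  have h1 : (1 - (ψ (b * u₀) : ℂ)) *
      ∫ u in Metric.closedBall 0 σ, (ψ (b * u) : ℂ) ∂(haar p) = 0 := by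
    rw [sub_mul, one_mul, ← hshift, sub_self]
  rcases mul_eq_zero.1 h1 with h2 | h2
  · exact (h (Circle.ext (by simpa using (sub_eq_zero.1 h2).symm))).elim
  · exact h2

lemma norm_natCast_le_one (m : ℕ) : ‖(m : ℚ_[p])‖ ≤ 1 := by
  exact_mod_cast Padic.norm_int_le_one (p := p) (m : ℤ)

/-- Differentiation introduces integer factors that may be p-adically small; `|d!|` bounds all of
them below at once. -/
lemma norm_factorial_le {d i : ℕ} (hi : 1 ≤ i) (hid : i ≤ d) :
    ‖(d.factorial : ℚ_[p])‖ ≤ ‖(i : ℚ_[p])‖ := by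
  obtain ⟨m, hm⟩ := Nat.dvd_factorial (by omega : 0 < i) hid
  rw [hm, Nat.cast_mul, norm_mul]
  exact mul_le_of_le_one_right (norm_nonneg _) (norm_natCast_le_one m)

lemma norm_factorial_pos (d : ℕ) : 0 < ‖(d.factorial : ℚ_[p])‖ :=
  norm_pos_iff.2 (Nat.cast_ne_zero.2 d.factorial_ne_zero)

lemma taylor_derivative_eq (g : ℚ_[p][X]) (y : ℚ_[p]) :
    taylor y (derivative g) = derivative (taylor y g) := by
  rw [taylor_apply, taylor_apply, derivative_comp]; simp

/-- Away from the roots of `g'`, `g` is close to its linearization. -/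
lemma norm_eval_add_sub_le {g : ℚ_[p][X]} {d : ℕ} (hg : g.natDegree ≤ d) {ρ : ℝ} (hρ : 0 < ρ)
    {y u : ℚ_[p]} (hy : y ∉ nearRoots (derivative g) ρ) (hu : ‖u‖ ≤ ρ) :
    ‖(d.factorial : ℚ_[p])‖ * ρ * ‖g.eval (y + u) - (g.eval y + (derivative g).eval y * u)‖ ≤
      ‖(derivative g).eval y‖ * ‖u‖ ^ 2 := by
  have hκ := norm_factorial_pos (p := p) d
  have hdom := constDominates_taylor hρ.le hy
  rw [mul_comm, ← le_div_iff₀ (by positivity)]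
  have hexp : g.eval (y + u) - (g.eval y + (derivative g).eval y * u) =
      ∑ i ∈ Finset.range d, (taylor y g).coeff (i + 2) * u ^ (i + 2) := by
    rw [add_comm y u, ← taylor_eval, eval_eq_sum_range' (n := d + 2)
      (by rw [natDegree_taylor]; omega), Finset.sum_range_succ', Finset.sum_range_succ']
    simp only [taylor_coeff_zero, zero_add, taylor_coeff_one, pow_zero, pow_one]
    ring
  rw [hexp]
  refine IsUltrametricDist.norm_sum_le_of_forall_le_of_nonneg (by positivity) fun i _ => ?_
  rw [le_div_iff₀ (by positivity)]
  by_cases hi : i + 2 ≤ d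
  -- Dominance holds for the expansion of `g'`, whose coefficient of index `i + 1` is `i + 2` times
  -- that of `g` of index `i + 2`.
  · have h1 := hdom (i + 1)
    rw [taylor_coeff_zero, taylor_derivative_eq, coeff_derivative, norm_mul] at h1
    have h2 := norm_factorial_le (p := p) (by omega : 1 ≤ i + 2) hi
    have h3 : ((i + 1 : ℕ) : ℚ_[p]) + 1 = ((i + 2 : ℕ) : ℚ_[p]) := by push_cast; ring
    rw [h3] at h1
    rw [norm_mul, norm_pow]
    calc ‖(taylor y g).coeff (i + 2)‖ * ‖u‖ ^ (i + 2) * (‖(d.factorial : ℚ_[p])‖ * ρ)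
        = ‖(taylor y g).coeff (i + 2)‖ * ‖(d.factorial : ℚ_[p])‖ * (‖u‖ ^ i * ρ) * ‖u‖ ^ 2 := by
          ring
      _ ≤ ‖(taylor y g).coeff (i + 2)‖ * ‖((i + 2 : ℕ) : ℚ_[p])‖ * (ρ ^ i * ρ) * ‖u‖ ^ 2 := by
          gcongr
      _ = ‖(taylor y g).coeff (i + 2)‖ * ‖((i + 2 : ℕ) : ℚ_[p])‖ * ρ ^ (i + 1) * ‖u‖ ^ 2 := by
          rw [pow_succ ρ i]
      _ ≤ _ := by gcongr
  · rw [coeff_eq_zero_of_natDegree_lt (by rw [natDegree_taylor]; omega)]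
    rw [zero_mul, norm_zero, zero_mul]; positivity

/-- A function invariant under translations by elements of norm at most `ρ`. -/
def BallInvariant {E α : Type*} [SeminormedAddCommGroup E] (φ : E → α) (ρ : ℝ) : Prop :=
  ∀ x u, ‖u‖ ≤ ρ → φ (x + u) = φ x

lemma BallInvariant.isLocallyConstant {E α : Type*} [SeminormedAddCommGroup E] {φ : E → α}
    {ρ : ℝ} (hρ : 0 < ρ) (h : BallInvariant φ ρ) : IsLocallyConstant φ := by
  rw [IsLocallyConstant.iff_eventually_eq]
  intro x
  filter_upwards [Metric.ball_mem_nhds x hρ] with y hy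
  rw [← h x (y - x) (by rw [← dist_eq_norm]; exact (Metric.mem_ball.1 hy).le)]
  congr 1; abel

lemma integrable_mul_addChar {ψ : AddChar ℚ_[p] Circle} (hψ : Continuous ψ) {φ : ℚ_[p] → ℂ}
    (hφ : Continuous φ) {R : ℝ} (hsupp : ∀ x, φ x ≠ 0 → ‖x‖ ≤ R) (g : ℚ_[p][X]) :
    Integrable (fun x => φ x * (ψ (g.eval x) : ℂ)) (haar p) := by
  refine Continuous.integrable_of_hasCompactSupport ?_ ?_
  · have := g.continuous
    fun_prop
  · refine HasCompactSupport.intro (isCompact_closedBall 0 R) fun x hx => ?_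
    have : φ x = 0 := by
      by_contra h
      exact hx (by simpa using hsupp x h)
    simp [this]

/-- `hK3` forces `|g'| ρ ≥ K` on the support of `φ` away from the roots of `g'`. Then `hK1` fits a
ball of radius `|u₁| / |g'|`, on which the linear part oscillates, inside one of radius `ρ`, and
`hK2` makes the nonlinear remainder there at most `η`. -/
lemma setIntegral_compl_nearRoots_eq_zero {ψ : AddChar ℚ_[p] Circle} (hψ : Continuous ψ)
    {u₁ : ℚ_[p]} (hu₁ : ψ u₁ ≠ 1) {η : ℝ} (hη : ∀ u, ‖u‖ ≤ η → ψ u = 1)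
    {φ : ℚ_[p] → ℂ} {R ρ K : ℝ} (hR : 1 ≤ R) (hρ : 0 < ρ) (hρ1 : ρ ≤ 1)
    (hφ : BallInvariant φ ρ) (hsupp : ∀ x, φ x ≠ 0 → ‖x‖ ≤ R)
    {g : ℚ_[p][X]} {d : ℕ} (hg : g.natDegree ≤ d) {k : ℕ} (hk : 1 ≤ k) (hkd : k ≤ d)
    (hK : 0 < K) (hK1 : ‖u₁‖ ≤ K) (hK2 : ‖u₁‖ ^ 2 ≤ ‖(d.factorial : ℚ_[p])‖ * η * K)
    (hK3 : K * R ^ (d - 1) ≤ ‖(d.factorial : ℚ_[p])‖ * ‖g.coeff k‖ * ρ ^ d) :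
    ∫ x in (nearRoots (derivative g) ρ)ᶜ, φ x * (ψ (g.eval x) : ℂ) ∂(haar p) = 0 := by
  have hκ := norm_factorial_pos (p := p) d
  have hNmeas : MeasurableSet (nearRoots (derivative g) ρ)ᶜ :=
    (isClopen_nearRoots _ hρ).compl.isOpen.measurableSet
  have hFint := integrable_mul_addChar hψ (hφ.isLocallyConstant hρ).continuous hsupp g
  have hu₁0 : u₁ ≠ 0 := by rintro rfl; exact hu₁ (AddChar.map_zero_eq_one ψ)
  rw [← integral_indicator hNmeas]
  -- The oscillation radius depends on `|g'(x)|`. Averaging over balls of radius `ρ` first makes it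
  -- constant, and a second averaging at that radius can follow.
  refine integral_eq_zero_of_forall_setIntegral (hFint.indicator hNmeas) hρ fun x => ?_
  have hmem : ∀ s : ℚ_[p], ‖s‖ ≤ ρ →
      (x - s ∈ nearRoots (derivative g) ρ ↔ x ∈ nearRoots (derivative g) ρ) := fun s hs => by
    rw [sub_eq_add_neg]; exact add_mem_nearRoots_iff (by rwa [norm_neg])
  have hφs : ∀ s : ℚ_[p], ‖s‖ ≤ ρ → φ (x - s) = φ x := fun s hs => by
    rw [sub_eq_add_neg]; exact hφ _ _ (by rwa [norm_neg])
  have hHmeas : MeasurableSet (Metric.closedBall (0 : ℚ_[p]) ρ) :=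
    Metric.isClosed_closedBall.measurableSet
  by_cases hgood : x ∈ nearRoots (derivative g) ρ ∨ φ x = 0
  · refine setIntegral_eq_zero_of_forall_eq_zero fun s hs => ?_
    have hs' : ‖s‖ ≤ ρ := by simpa using hs
    rcases hgood with h | h
    · exact Set.indicator_of_notMem (Set.notMem_compl_iff.2 ((hmem s hs').2 h)) _
    · rw [Set.indicator_apply_eq_zero]
      intro _
      rw [hφs s hs', h, zero_mul]
  push Not at hgood
  obtain ⟨hx, hφx⟩ := hgood
  have hxR : ‖x‖ ≤ R := hsupp x hφx
  set b : ℝ := ‖(derivative g).eval x‖ with hb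
  have hKb : K ≤ b * ρ := by
    have h1 := norm_coeff_le (D := d - 1) ((natDegree_derivative_le g).trans (by omega)) hρ hρ1 hR
      hxR hx (k - 1)
    rw [coeff_derivative, norm_mul, Nat.sub_add_cancel hk] at h1
    have h2 : (((k - 1 : ℕ) : ℚ_[p]) + 1) = (k : ℚ_[p]) := by
      rw [← Nat.cast_succ, Nat.succ_eq_add_one, Nat.sub_add_cancel hk]
    rw [h2] at h1
    have h3 := norm_factorial_le (p := p) hk hkd
    have h4 : ρ ^ d = ρ ^ (d - 1) * ρ := by rw [← pow_succ, Nat.sub_add_cancel (by omega)]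
    have h5 : K * R ^ (d - 1) ≤ (b * ρ) * R ^ (d - 1) := by
      calc K * R ^ (d - 1) ≤ ‖(d.factorial : ℚ_[p])‖ * ‖g.coeff k‖ * ρ ^ d := hK3
        _ ≤ ‖(k : ℚ_[p])‖ * ‖g.coeff k‖ * ρ ^ d := by gcongr
        _ = (‖g.coeff k‖ * ‖(k : ℚ_[p])‖ * ρ ^ (d - 1)) * ρ := by rw [h4]; ring
        _ ≤ (R ^ (d - 1) * b) * ρ := by gcongr
        _ = _ := by ring
    exact le_of_mul_le_mul_right h5 (by positivity)
  have hbpos : 0 < b := pos_of_mul_pos_left (hK.trans_le hKb) hρ.le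
  have hσpos : 0 < ‖u₁‖ / b := div_pos (norm_pos_iff.2 hu₁0) hbpos
  have hσρ : ‖u₁‖ / b ≤ ρ := by rw [div_le_iff₀ hbpos, mul_comm]; exact hK1.trans hKb
  rw [← integral_indicator hHmeas]
  refine integral_eq_zero_of_forall_setIntegral (σ := ‖u₁‖ / b) ?_ hσpos fun s => ?_
  · refine Integrable.indicator ?_ hHmeas
    exact (hFint.indicator hNmeas).comp_sub_left x
  have hsu : ∀ u : ℚ_[p], ‖u‖ ≤ ‖u₁‖ / b → (s - u ∈ Metric.closedBall (0 : ℚ_[p]) ρ ↔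
      s ∈ Metric.closedBall (0 : ℚ_[p]) ρ) := by
    intro u hu
    simp only [mem_closedBall_zero_iff]
    refine ⟨fun h => ?_, fun h => (norm_sub_le_norm_max _ _).trans (max_le h (hu.trans hσρ))⟩
    rw [← sub_add_cancel s u]
    exact (IsUltrametricDist.norm_add_le_max _ _).trans (max_le h (hu.trans hσρ))
  have hSmeas : MeasurableSet (Metric.closedBall (0 : ℚ_[p]) (‖u₁‖ / b)) :=
    Metric.isClosed_closedBall.measurableSet
  by_cases hs : s ∈ Metric.closedBall (0 : ℚ_[p]) ρ
  swap
  · refine setIntegral_eq_zero_of_forall_eq_zero fun u hu => ?_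
    exact Set.indicator_of_notMem (fun h => hs ((hsu u (by simpa using hu)).1 h)) _
  have hs' : ‖s‖ ≤ ρ := by simpa using hs
  set y := x - s with hydef
  have hy : y ∉ nearRoots (derivative g) ρ := fun h => hx ((hmem s hs').1 h)
  have hby : ‖(derivative g).eval y‖ = b :=
    norm_eval_eq_of_norm_sub_le hρ.le hx (by rw [hydef, sub_sub_cancel_left, norm_neg]; exact hs')
  have hy0 : (derivative g).eval y ≠ 0 := by rw [← norm_pos_iff, hby]; exact hbpos
  have hchar := setIntegral_addChar_eq_zero (ψ := ψ) (b := (derivative g).eval y)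
    (u₀ := u₁ / (derivative g).eval y) (σ := ‖u₁‖ / b) (by rw [norm_div, hby])
    (by rwa [mul_div_cancel₀ _ hy0])
  rw [← mul_zero (φ x * (ψ (g.eval y) : ℂ)), ← hchar, ← integral_const_mul]
  refine setIntegral_congr_fun hSmeas fun u hu => ?_
  have hu' : ‖u‖ ≤ ‖u₁‖ / b := by simpa using hu
  have hsu' := (hsu u hu').2 hs
  have hsun : ‖s - u‖ ≤ ρ := by simpa using hsu'
  rw [Set.indicator_of_mem hsu',
    Set.indicator_of_mem (show x - (s - u) ∈ (nearRoots (derivative g) ρ)ᶜ from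
      fun h => hx ((hmem _ hsun).1 h)), hφs _ hsun, mul_assoc]
  congr 1
  rw [show x - (s - u) = y + u by rw [hydef]; ring, ← Circle.coe_mul, ← AddChar.map_add_eq_mul]
  have hrest : ψ (g.eval (y + u) - (g.eval y + (derivative g).eval y * u)) = 1 := by
    apply hη
    have h1 := norm_eval_add_sub_le hg hρ hy (hu'.trans hσρ)
    rw [hby] at h1
    have h2 : b * ‖u‖ ^ 2 ≤ ‖u₁‖ ^ 2 / b := by
      calc b * ‖u‖ ^ 2 ≤ b * (‖u₁‖ / b) ^ 2 := by gcongr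
        _ = ‖u₁‖ ^ 2 / b := by field_simp
    have hη0 : 0 ≤ η := by
      by_contra! h
      have : ‖(d.factorial : ℚ_[p])‖ * η * K < 0 :=
        mul_neg_of_neg_of_pos (mul_neg_of_pos_of_neg hκ h) hK
      linarith [sq_nonneg ‖u₁‖]
    have h3 : ‖u₁‖ ^ 2 / b ≤ ‖(d.factorial : ℚ_[p])‖ * ρ * η := by
      rw [div_le_iff₀ hbpos]
      calc _ ≤ _ := hK2
        _ ≤ ‖(d.factorial : ℚ_[p])‖ * η * (b * ρ) := by gcongr
        _ = _ := by ring
    exact le_of_mul_le_mul_left ((h1.trans h2).trans h3) (by positivity)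
  have hsplit := AddChar.map_add_eq_mul ψ (g.eval (y + u) - (g.eval y + (derivative g).eval y * u))
    (g.eval y + (derivative g).eval y * u)
  rw [sub_add_cancel, hrest, one_mul] at hsplit
  rw [hsplit]

/-- A continuous character of `ℚ_[p]` is trivial near `0`. -/
lemma exists_forall_addChar_eq_one {ψ : AddChar ℚ_[p] Circle} (hψ : Continuous ψ) :
    ∃ η : ℝ, 0 < η ∧ ∀ u, ‖u‖ ≤ η → ψ u = 1 := by
  have hcont : Continuous fun u => (ψ u : ℂ) := by fun_prop
  obtain ⟨η, hη, hball⟩ := Metric.continuous_iff.1 hcont 0 (1 / 2) (by norm_num)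
  simp only [sub_zero, AddChar.map_zero_eq_one, Circle.coe_one, dist_eq_norm] at hball
  refine ⟨η / 2, by positivity, fun u hu => ?_⟩
  -- Doubling preserves the ball, and `ψ(2u) - 1 = (ψ(u) - 1)(ψ(u) + 1)` with `|ψ(u) + 1| ≥ 3/2`, so
  -- each doubling improves the bound on `|ψ(u) - 1|` by `2/3`.
  have key : ∀ (m : ℕ) (u : ℚ_[p]), ‖u‖ < η → ‖(ψ u : ℂ) - 1‖ ≤ (2 / 3 : ℝ) ^ m := by
    intro m
    induction m with
    | zero => intro u hu; rw [pow_zero]; exact (hball u hu).le.trans (by norm_num)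
    | succ m ih =>
      intro u hu
      have h1 := ih (u + u) ((IsUltrametricDist.norm_add_le_max _ _).trans_lt (by simpa using hu))
      rw [AddChar.map_add_eq_mul, Circle.coe_mul,
        show (ψ u : ℂ) * ψ u - 1 = ((ψ u : ℂ) - 1) * (ψ u + 1) by ring, norm_mul] at h1
      have h2 : (3 / 2 : ℝ) ≤ ‖(ψ u : ℂ) + 1‖ := by
        have h3 := norm_sub_norm_le (2 : ℂ) (1 - (ψ u : ℂ))
        rw [norm_sub_rev 1, show (2 : ℂ) - (1 - ψ u) = ψ u + 1 by ring] at h3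
        have := hball u hu
        have h4 : ‖(2 : ℂ)‖ = 2 := by simp
        linarith
      have h5 := mul_le_mul_of_nonneg_left h2 (norm_nonneg ((ψ u : ℂ) - 1))
      rw [pow_succ]; linarith
  have hlim := tendsto_pow_atTop_nhds_zero_of_lt_one (r := (2 / 3 : ℝ)) (by norm_num) (by norm_num)
  have h0 := ge_of_tendsto' hlim fun m => key m u (by linarith)
  exact Circle.ext (by simpa [sub_eq_zero] using h0)

/-! ### Exponential integrals in one variable -/

/-- Uniform decay of exponential integrals in one variable. -/
lemma norm_integral_mul_addChar_le {ψ : AddChar ℚ_[p] Circle} (hψ : Continuous ψ) (hψ1 : ψ ≠ 1)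
    {d : ℕ} (hd : d ≠ 0) {R Φ : ℝ} (hR : 1 ≤ R) (hΦ : 0 ≤ Φ) (N : ℕ) :
    ∃ C : ℝ, 0 ≤ C ∧ ∀ φ : ℚ_[p] → ℂ, (∀ x, ‖φ x‖ ≤ Φ) → BallInvariant φ ((p : ℝ) ^ N)⁻¹ →
      (∀ x, φ x ≠ 0 → ‖x‖ ≤ R) → ∀ g : ℚ_[p][X], g.natDegree ≤ d → ∀ k, 1 ≤ k → k ≤ d →
      ‖∫ x, φ x * (ψ (g.eval x) : ℂ) ∂(haar p)‖ ≤
        C * (max 1 ‖g.coeff k‖) ^ (-(1 / (d : ℝ))) := by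
  have hp1 : (1 : ℝ) < p := by exact_mod_cast (Fact.out : p.Prime).one_lt
  have hκ := norm_factorial_pos (p := p) d
  obtain ⟨u₁, hu₁⟩ : ∃ u₁, ψ u₁ ≠ 1 := by
    by_contra! h
    exact hψ1 (by ext u; simp [h u])
  obtain ⟨η, hη0, hη⟩ : ∃ η : ℝ, 0 < η ∧ ∀ u, ‖u‖ ≤ η → ψ u = 1 :=
    exists_forall_addChar_eq_one hψ
  obtain ⟨K, hK0, hK1, hK2⟩ : ∃ K : ℝ, 0 < K ∧ ‖u₁‖ ≤ K ∧
      ‖u₁‖ ^ 2 ≤ ‖(d.factorial : ℚ_[p])‖ * η * K := by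
    refine ⟨max 1 (max ‖u₁‖ (‖u₁‖ ^ 2 / (‖(d.factorial : ℚ_[p])‖ * η))), by positivity,
      (le_max_left _ _).trans (le_max_right _ _), ?_⟩
    rw [← div_le_iff₀' (by positivity)]
    exact (le_max_right _ _).trans (le_max_right _ _)
  obtain ⟨A, hA1, hA⟩ : ∃ A : ℝ, 1 ≤ A ∧ K * R ^ (d - 1) ≤ ‖(d.factorial : ℚ_[p])‖ * A ^ d := by
    refine ⟨max 1 (K * R ^ (d - 1) / ‖(d.factorial : ℚ_[p])‖), le_max_left _ _, ?_⟩
    rw [← div_le_iff₀' hκ]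
    exact (le_max_right _ _).trans (le_self_pow₀ (le_max_left _ _) hd)
  set V := (haar p).real (Metric.closedBall 0 R) with hV
  have hA0 : 0 < A := by linarith
  -- The first summand serves small `|g_k|`, where the trivial bound suffices; the second serves
  -- large `|g_k|`, through the measure of the deleted neighbourhood.
  refine ⟨Φ * V * (A * p ^ N) + Φ * d * (A * p), by positivity, ?_⟩
  intro φ hφ hinv hsupp g hg k hk hkd
  set w := (max 1 ‖g.coeff k‖) ^ (-(1 / (d : ℝ))) with hw
  have hw0 : 0 < w := Real.rpow_pos_of_pos (lt_max_of_lt_left one_pos) _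
  have hFint := integrable_mul_addChar hψ
    (hinv.isLocallyConstant (by positivity)).continuous hsupp g
  have hFle : ∀ x, ‖φ x * (ψ (g.eval x) : ℂ)‖ ≤ Φ := fun x => by
    rw [norm_mul, Circle.norm_coe, mul_one]; exact hφ x
  have hp0 : (0 : ℝ) < p := by linarith
  by_cases hN : (A * (p : ℝ) ^ N) ^ d ≤ ‖g.coeff k‖
  -- The radius `p^(-j)` is comparable to `|g_k|^(-1/d)`: the lower bound on `|g_k|` yields the
  -- vanishing, the upper bound makes the deleted set small. `N ≤ j` keeps `φ` invariant at this
  -- radius.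
  · obtain ⟨j, hNj, hj, hj1⟩ : ∃ j, N ≤ j ∧ (A * (p : ℝ) ^ j) ^ d ≤ ‖g.coeff k‖ ∧
        ‖g.coeff k‖ < (A * (p : ℝ) ^ (j + 1)) ^ d := by
      by_contra! h
      have hall : ∀ j, N ≤ j → (A * (p : ℝ) ^ j) ^ d ≤ ‖g.coeff k‖ := fun j hj => by
        induction j, hj using Nat.le_induction with
        | base => exact hN
        | succ j hj ih => exact h j hj ih
      obtain ⟨m, hm⟩ := pow_unbounded_of_one_lt ‖g.coeff k‖ hp1
      have h1 := hall (max N m) (le_max_left _ _)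
      have h2 : (p : ℝ) ^ m ≤ A * (p : ℝ) ^ max N m :=
        (pow_le_pow_right₀ hp1.le (le_max_right N m)).trans
          (le_mul_of_one_le_left (by positivity) hA1)
      have h3 : A * (p : ℝ) ^ max N m ≤ (A * (p : ℝ) ^ max N m) ^ d :=
        le_self_pow₀ (one_le_mul_of_one_le_of_one_le hA1 (one_le_pow₀ hp1.le)) hd
      linarith
    set ρ : ℝ := ((p : ℝ) ^ j)⁻¹ with hρ
    have hρ0 : 0 < ρ := by positivity
    have hρ1 : ρ ≤ 1 := inv_le_one_of_one_le₀ (one_le_pow₀ hp1.le)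
    have hρN : ρ ≤ ((p : ℝ) ^ N)⁻¹ := by
      rw [hρ]; gcongr; exact hp1.le
    have hNmeas : MeasurableSet (nearRoots (derivative g) ρ) :=
      (isClopen_nearRoots _ hρ0).isOpen.measurableSet
    have hzero := setIntegral_compl_nearRoots_eq_zero hψ hu₁ hη hR hρ0 hρ1
      (fun x u hu => hinv x u (hu.trans hρN)) hsupp hg hk hkd hK0 hK1 hK2 (by
        refine hA.trans ?_
        rw [mul_assoc]
        gcongr
        rw [hρ, inv_pow, ← div_eq_mul_inv, le_div_iff₀ (by positivity), ← mul_pow]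
        exact hj)
    rw [← integral_add_compl hNmeas hFint, hzero, add_zero]
    obtain ⟨hbad, hbadfin⟩ := haar_nearRoots_le (q := derivative g) (D := d)
      ((natDegree_derivative_le g).trans (by omega)) j
    have h1 := norm_setIntegral_le_of_norm_le_const hbadfin.lt_top fun x _ => hFle x
    have h2 : (A * (p : ℝ) ^ (j + 1))⁻¹ ≤ w :=
      inv_le_rpow_neg hd (one_le_mul_of_one_le_of_one_le hA1 (one_le_pow₀ hp1.le)) hj1.le
    have h3 : ρ ≤ A * p * w := by
      calc ρ = A * p * (A * (p : ℝ) ^ (j + 1))⁻¹ := by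
            rw [hρ, pow_succ]; field_simp
        _ ≤ _ := by gcongr
    calc _ ≤ Φ * (haar p).real (nearRoots (derivative g) ρ) := h1
      _ ≤ Φ * (d * (A * p * w)) := by
          gcongr; exact hbad.trans (by gcongr)
      _ = Φ * d * (A * p) * w := by ring
      _ ≤ _ := by gcongr; exact le_add_of_nonneg_left (by positivity)
  · push Not at hN
    have h2 : (A * (p : ℝ) ^ N)⁻¹ ≤ w :=
      inv_le_rpow_neg hd (one_le_mul_of_one_le_of_one_le hA1 (one_le_pow₀ hp1.le)) hN.le
    have h3 : 1 ≤ A * p ^ N * w := by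
      rw [inv_le_iff_one_le_mul₀ (by positivity), mul_comm] at h2; exact h2
    have hS : ∫ x, φ x * (ψ (g.eval x) : ℂ) ∂(haar p) =
        ∫ x in Metric.closedBall 0 R, φ x * (ψ (g.eval x) : ℂ) ∂(haar p) := by
      rw [setIntegral_eq_integral_of_forall_compl_eq_zero]
      intro x hx
      have : φ x = 0 := by
        by_contra h
        exact hx (by simpa using hsupp x h)
      rw [this, zero_mul]
    rw [hS]
    calc _ ≤ Φ * V := norm_setIntegral_le_of_norm_le_const
            (isCompact_closedBall _ _).measure_lt_top fun x _ => hFle x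
      _ ≤ Φ * V * (A * p ^ N * w) := le_mul_of_one_le_right (by positivity) h3
      _ = Φ * V * (A * p ^ N) * w := by ring
      _ ≤ _ := by gcongr; exact le_add_of_nonneg_right (by positivity)

/-! ### Slices of polynomials of bounded partial degree -/

/-- The polynomial function with degree at most `d` in every variable and coefficients `c`. -/
def boxEval {n d : ℕ} (c : (Fin n → Fin (d + 1)) → ℚ_[p]) (x : Fin n → ℚ_[p]) : ℚ_[p] :=
  ∑ e, c e * ∏ i, x i ^ (e i : ℕ)

lemma continuous_boxEval {n d : ℕ} (c : (Fin n → Fin (d + 1)) → ℚ_[p]) :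
    Continuous (boxEval c) := by
  unfold boxEval; fun_prop

/-- `boxEval c` as a polynomial in the `i`-th variable, the other variables being fixed. -/
def boxSlice {n d : ℕ} (i : Fin (n + 1)) (c : (Fin (n + 1) → Fin (d + 1)) → ℚ_[p])
    (x : Fin n → ℚ_[p]) : ℚ_[p][X] :=
  ∑ k : Fin (d + 1), monomial k
    (boxEval (fun e => c (i.insertNth (α := fun _ => Fin (d + 1)) k e)) x)

lemma natDegree_boxSlice_le {n d : ℕ} (i : Fin (n + 1))
    (c : (Fin (n + 1) → Fin (d + 1)) → ℚ_[p]) (x : Fin n → ℚ_[p]) :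
    (boxSlice i c x).natDegree ≤ d :=
  natDegree_sum_le_of_forall_le _ _ fun k _ =>
    (natDegree_monomial_le _).trans (Nat.lt_succ_iff.1 k.isLt)

lemma coeff_boxSlice {n d : ℕ} (i : Fin (n + 1)) (c : (Fin (n + 1) → Fin (d + 1)) → ℚ_[p])
    (x : Fin n → ℚ_[p]) (k : Fin (d + 1)) : (boxSlice i c x).coeff k =
      boxEval (fun e => c (i.insertNth (α := fun _ => Fin (d + 1)) k e)) x := by
  simp [boxSlice, finsetSum_coeff, coeff_monomial, Fin.val_inj]

lemma eval_boxSlice {n d : ℕ} (i : Fin (n + 1)) (c : (Fin (n + 1) → Fin (d + 1)) → ℚ_[p])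
    (x : Fin n → ℚ_[p]) (t : ℚ_[p]) :
    (boxSlice i c x).eval t = boxEval c (i.insertNth (α := fun _ => ℚ_[p]) t x) := by
  rw [boxSlice, eval_finsetSum, boxEval,
    ← (Fin.insertNthEquiv (fun _ => Fin (d + 1)) i).sum_comp, Fintype.sum_prod_type]
  refine Finset.sum_congr rfl fun k _ => ?_
  rw [eval_monomial, boxEval, Finset.sum_mul]
  refine Finset.sum_congr rfl fun e _ => ?_
  rw [Fin.prod_univ_succAbove _ i]
  simp only [Fin.insertNthEquiv_apply, Fin.insertNth_apply_same, Fin.insertNth_apply_succAbove]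
  change _ = c (i.insertNth (α := fun _ => Fin (d + 1)) k e) * _
  ring

/-- The restriction of the Haar measure to the polydisc of radius `R`. -/
def haarBox (p : ℕ) [Fact p.Prime] (n : ℕ) (R : ℝ) : Measure (Fin n → ℚ_[p]) :=
  Measure.pi fun _ => haarBall p R

instance instIsFiniteMeasureHaarBox (n : ℕ) (R : ℝ) : IsFiniteMeasure (haarBox p n R) := by
  unfold haarBox; infer_instance

lemma integrable_haarBox {E : Type*} [NormedAddCommGroup E] [SecondCountableTopology E]
    {n : ℕ} {R B : ℝ} {F : (Fin n → ℚ_[p]) → E}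
    (hF : Continuous F) (hB : ∀ x, ‖F x‖ ≤ B) : Integrable F (haarBox p n R) := by
  borelize E
  exact Integrable.of_bound hF.measurable.aestronglyMeasurable B (.of_forall hB)

lemma integral_haarBox_succ {E : Type*} [NormedAddCommGroup E] [NormedSpace ℝ E] {n : ℕ} {R : ℝ}
    (i : Fin (n + 1)) {F : (Fin (n + 1) → ℚ_[p]) → E} (hF : Integrable F (haarBox p (n + 1) R)) :
    ∫ x, F x ∂(haarBox p (n + 1) R) =
      ∫ x, ∫ t, F (i.insertNth (α := fun _ => ℚ_[p]) t x) ∂(haarBall p R) ∂(haarBox p n R) := by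
  have hmp := (measurePreserving_piFinSuccAbove (fun _ : Fin (n + 1) => haarBall p R) i).symm
  rw [haarBox, ← hmp.integral_comp', integral_prod_symm]
  · rfl
  · exact (hmp.integrable_comp_emb (MeasurableEquiv.measurableEmbedding _)).2 hF

lemma continuous_decayWeight_boxEval {n d : ℕ} (c : (Fin n → Fin (d + 1)) → ℚ_[p]) (L : ℕ) :
    Continuous fun x => decayWeight p d L ‖boxEval c x‖ :=
  (continuous_decayWeight p d L).comp (continuous_boxEval c).norm

lemma norm_decayWeight_le_one (p d L : ℕ) (t : ℝ) : ‖decayWeight p d L t‖ ≤ 1 := by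
  rw [Real.norm_of_nonneg (decayWeight_pos p d L t).le]; exact decayWeight_le_one p d L t

/-! ### Estimates in several variables -/

/-- Weighted sublevel estimate in several variables. -/
lemma integral_decayWeight_boxEval_le {d : ℕ} (hd : d ≠ 0) {R : ℝ} (hR : 1 ≤ R) (n : ℕ) :
    ∃ C : ℝ, 0 ≤ C ∧ ∀ (c : (Fin n → Fin (d + 1)) → ℚ_[p]) (e : Fin n → Fin (d + 1)) (L : ℕ),
      ∫ x, decayWeight p d L ‖boxEval c x‖ ∂(haarBox p n R) ≤
        C * (L + 1) ^ n * decayWeight p d L ‖c e‖ := by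
  induction n with
  | zero =>
    refine ⟨1, zero_le_one, fun c e L => ?_⟩
    have : ∀ x : Fin 0 → ℚ_[p], boxEval c x = c e := fun x => by
      rw [boxEval, Fintype.sum_subsingleton _ e]; simp
    simp [this, haarBox, measureReal_def]
  | succ n ih =>
    obtain ⟨C, hC, ih⟩ := ih
    obtain ⟨C₁, hC₁, h₁⟩ := integral_decayWeight_le (p := p) hd hR
    refine ⟨C₁ * C, by positivity, fun c e L => ?_⟩
    -- The slice is compared with its coefficient of index `e 0`, a polynomial in the remaining
    -- variables that still has `c e` as a coefficient.
    have hfib : ∀ x : Fin n → ℚ_[p], ∫ t, decayWeight p d L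
        ‖boxEval c ((0 : Fin (n + 1)).insertNth (α := fun _ => ℚ_[p]) t x)‖ ∂(haarBall p R) ≤
        C₁ * (L + 1) * decayWeight p d L ‖boxEval (fun e' => c ((0 : Fin (n + 1)).insertNth
          (α := fun _ => Fin (d + 1)) (e 0) e')) x‖ := fun x => by
      simp only [← eval_boxSlice, ← coeff_boxSlice]
      exact h₁ _ (natDegree_boxSlice_le _ _ _) _ _
    rw [integral_haarBox_succ 0 (integrable_haarBox (continuous_decayWeight_boxEval c L)
      fun x => norm_decayWeight_le_one p d L _)]
    calc _ ≤ ∫ x, C₁ * (L + 1) * decayWeight p d L ‖boxEval (fun e' =>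
            c ((0 : Fin (n + 1)).insertNth (α := fun _ => Fin (d + 1)) (e 0) e')) x‖
            ∂(haarBox p n R) :=
          integral_mono_of_nonneg
            (.of_forall fun x => integral_nonneg fun t => (decayWeight_pos _ _ _ _).le)
            ((integrable_haarBox (continuous_decayWeight_boxEval _ L)
              fun x => norm_decayWeight_le_one p d L _).const_mul _) (.of_forall hfib)
      _ ≤ C₁ * (L + 1) * (C * (L + 1) ^ n * decayWeight p d L ‖c e‖) := by
          rw [integral_const_mul]
          gcongr
          have := ih (fun e' => c ((0 : Fin (n + 1)).insertNth
            (α := fun _ => Fin (d + 1)) (e 0) e')) (Fin.removeNth 0 e) L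
          rwa [Fin.insertNth_self_removeNth] at this
      _ = _ := by ring

/-- Uniform decay of exponential integrals in several variables. -/
lemma norm_integral_boxEval_le {ψ : AddChar ℚ_[p] Circle} (hψ : Continuous ψ) (hψ1 : ψ ≠ 1)
    {d : ℕ} (hd : d ≠ 0) {R Φ : ℝ} (hR : 1 ≤ R) (hΦ : 0 ≤ Φ) (N n : ℕ) :
    ∃ C : ℝ, 0 ≤ C ∧ ∀ φ : (Fin (n + 1) → ℚ_[p]) → ℂ, (∀ x, ‖φ x‖ ≤ Φ) →
      BallInvariant φ ((p : ℝ) ^ N)⁻¹ → (∀ x, φ x ≠ 0 → ‖x‖ ≤ R) →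
      ∀ (c : (Fin (n + 1) → Fin (d + 1)) → ℚ_[p]) (e : Fin (n + 1) → Fin (d + 1)), e ≠ 0 →
      ∀ L : ℕ, ‖∫ x, φ x * (ψ (boxEval c x) : ℂ) ∂(haarBox p (n + 1) R)‖ ≤
        C * (L + 1) ^ n * decayWeight p d L ‖c e‖ := by
  obtain ⟨C₁, hC₁, h₁⟩ := norm_integral_mul_addChar_le hψ hψ1 hd hR hΦ N
  obtain ⟨C₂, hC₂, h₂⟩ := integral_decayWeight_boxEval_le (p := p) hd hR n
  refine ⟨C₁ * C₂, by positivity, fun φ hφ hinv hsupp c e he L => ?_⟩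
  -- In this variable `c e` belongs to a nonconstant coefficient of the slice, so oscillation is
  -- available. It costs no logarithm; only the other `n` variables do.
  obtain ⟨i, hi⟩ := Function.ne_iff.1 he
  have hp0 : (0 : ℝ) < p := by exact_mod_cast (Fact.out : p.Prime).pos
  have hφc : Continuous φ := (hinv.isLocallyConstant (by positivity)).continuous
  have hcont : Continuous fun x => φ x * (ψ (boxEval c x) : ℂ) := by
    have := continuous_boxEval c
    fun_prop
  have hfib : ∀ x : Fin n → ℚ_[p],
      ‖∫ t, φ (i.insertNth (α := fun _ => ℚ_[p]) t x) *
        (ψ (boxEval c (i.insertNth (α := fun _ => ℚ_[p]) t x)) : ℂ) ∂(haarBall p R)‖ ≤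
      C₁ * decayWeight p d L ‖boxEval (fun e' => c (i.insertNth
          (α := fun _ => Fin (d + 1)) (e i) e')) x‖ := fun x => by
    have hs : ∀ t, φ (i.insertNth (α := fun _ => ℚ_[p]) t x) ≠ 0 → ‖t‖ ≤ R := fun t ht => by
      have := (norm_le_pi_norm (i.insertNth (α := fun _ => ℚ_[p]) t x) i).trans (hsupp _ ht)
      rwa [Fin.insertNth_apply_same] at this
    have hinv' : BallInvariant (fun t => φ (i.insertNth (α := fun _ => ℚ_[p]) t x))
        ((p : ℝ) ^ N)⁻¹ := fun t u hu => by
      have e1 : i.insertNth (α := fun _ => ℚ_[p]) (t + u) x =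
          i.insertNth (α := fun _ => ℚ_[p]) t x + Pi.single i u := by
        rw [Fin.insertNth_eq_iff]
        refine ⟨by simp, funext fun j => ?_⟩
        simp [Fin.removeNth]
      simp only [e1]
      exact hinv _ _ (by rwa [Pi.norm_single])
    have h3 := h₁ (fun t => φ (i.insertNth (α := fun _ => ℚ_[p]) t x)) (fun t => hφ _) hinv' hs
      (boxSlice i c x) (natDegree_boxSlice_le i c x) (e i)
      (Nat.one_le_iff_ne_zero.2 fun h => hi (Fin.ext h)) (Nat.lt_succ_iff.1 (e i).isLt)
    simp only [eval_boxSlice, coeff_boxSlice] at h3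
    rw [haarBall, setIntegral_eq_integral_of_forall_compl_eq_zero]
    · refine h3.trans ?_
      gcongr
      exact rpow_neg_le_decayWeight p d L _
    · intro t ht
      have : φ (i.insertNth (α := fun _ => ℚ_[p]) t x) = 0 := by
        by_contra h
        exact ht (by simpa using hs t h)
      rw [this, zero_mul]
  rw [integral_haarBox_succ i (integrable_haarBox hcont (B := Φ) fun x => by
    rw [norm_mul, Circle.norm_coe, mul_one]; exact hφ x)]
  refine (norm_integral_le_of_norm_le ((integrable_haarBox (continuous_decayWeight_boxEval _ L)
    fun x => norm_decayWeight_le_one p d L _).const_mul C₁) (.of_forall hfib)).trans ?_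
  rw [integral_const_mul, mul_assoc C₁, mul_assoc C₁]
  gcongr
  have := h₂ (fun e' => c (i.insertNth (α := fun _ => Fin (d + 1)) (e i) e'))
    (Fin.removeNth i e) L
  rwa [Fin.insertNth_self_removeNth] at this

end Polynomial

variable {p : ℕ} [Fact p.Prime]

/-! ### Coefficients of `y ⬝ f` -/

/-- A tuple of exponents bounded by `d` as a finitely supported function. -/
def boxExponent {n d : ℕ} (e : Fin n → Fin (d + 1)) : Fin n →₀ ℕ :=
  Finsupp.equivFunOnFinite.symm fun i => (e i : ℕ)

lemma boxExponent_injective {n d : ℕ} :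
    Function.Injective (boxExponent : (Fin n → Fin (d + 1)) → Fin n →₀ ℕ) := fun _ _ h =>
  funext fun i => Fin.ext (DFunLike.congr_fun h i)

lemma exists_boxExponent_eq {n d : ℕ} {m : Fin n →₀ ℕ} (hm : ∀ i, m i ≤ d) :
    ∃ e : Fin n → Fin (d + 1), boxExponent e = m :=
  ⟨fun i => ⟨m i, Nat.lt_succ_iff.2 (hm i)⟩, Finsupp.ext fun _ => rfl⟩

lemma eval_eq_boxEval {n d : ℕ} {f : MvPolynomial (Fin n) ℚ_[p]} (hf : ∀ j, f.degreeOf j ≤ d)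
    (x : Fin n → ℚ_[p]) : MvPolynomial.eval x f =
      boxEval (fun e : Fin n → Fin (d + 1) => f.coeff (boxExponent e)) x := by
  classical
  rw [MvPolynomial.eval_eq', boxEval]
  have h : ∑ e : Fin n → Fin (d + 1), f.coeff (boxExponent e) * ∏ i, x i ^ (e i : ℕ) =
      ∑ m ∈ Finset.univ.image (boxExponent (n := n) (d := d)), f.coeff m * ∏ i, x i ^ m i := by
    rw [Finset.sum_image fun _ _ _ _ h => boxExponent_injective h]; rfl
  rw [h]
  refine Finset.sum_subset (fun m hm => ?_) fun m _ hm => ?_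
  · obtain ⟨e, he⟩ := exists_boxExponent_eq (d := d)
      fun i => MvPolynomial.degreeOf_le_iff.1 (hf i) m hm
    exact Finset.mem_image.2 ⟨e, Finset.mem_univ _, he⟩
  · rw [MvPolynomial.notMem_support_iff.1 hm, zero_mul]

lemma degreeOf_le_maxPartialDegree {n r : ℕ} (f : Fin r → MvPolynomial (Fin n) ℚ_[p])
    (i : Fin r) (j : Fin n) : (f i).degreeOf j ≤ maxPartialDegree f :=
  (Finset.le_sup (f := fun j => (f i).degreeOf j) (Finset.mem_univ j)).trans
    (Finset.le_sup (f := fun i => Finset.univ.sup fun j => (f i).degreeOf j) (Finset.mem_univ i))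

lemma boxEval_sum {n d r : ℕ} (c : Fin r → (Fin n → Fin (d + 1)) → ℚ_[p]) (y : Fin r → ℚ_[p])
    (x : Fin n → ℚ_[p]) : y ⬝ᵥ (fun i => boxEval (c i) x) =
      boxEval (fun e => ∑ i, y i * c i e) x := by
  simp only [dotProduct, boxEval, Finset.mul_sum, Finset.sum_mul]
  rw [Finset.sum_comm]
  simp only [mul_assoc]

/-- Some nonconstant coefficient of `y ⬝ f` has norm comparable to `‖y‖`. -/
lemma exists_le_norm_coeff {n r : ℕ} {f : Fin r → MvPolynomial (Fin n) ℚ_[p]}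
    (hf : LinearIndependent ℚ_[p] (Fin.cons 1 f : Fin (r + 1) → MvPolynomial (Fin n) ℚ_[p])) :
    ∃ B : ℝ, 1 ≤ B ∧ ∀ y : Fin r → ℚ_[p], y ≠ 0 →
      ∃ e : Fin n → Fin (maxPartialDegree f + 1), e ≠ 0 ∧
        ‖y‖ ≤ B * ‖∑ i, y i * (f i).coeff (boxExponent e)‖ := by
  set d := maxPartialDegree f with hd
  let T : (Fin r → ℚ_[p]) →ₗ[ℚ_[p]] ({e : Fin n → Fin (d + 1) // e ≠ 0} → ℚ_[p]) :=
    { toFun := fun y e => ∑ i, y i * (f i).coeff (boxExponent e.1)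
      map_add' := fun y z => by
        ext e; simp [add_mul, Finset.sum_add_distrib]
      map_smul' := fun a y => by
        ext e; simp [Finset.mul_sum, mul_assoc] }
  -- If all nonconstant coefficients of `y ⬝ f` vanish, it is a constant, which is a linear relation
  -- between `1` and the `f i`.
  have hker : T.ker = ⊥ := by
    rw [LinearMap.ker_eq_bot']
    intro y hy
    set g : MvPolynomial (Fin n) ℚ_[p] := ∑ i, y i • f i with hg
    have hcoeff : ∀ m, g.coeff m = ∑ i, y i * (f i).coeff m := fun m => by
      simp [hg, MvPolynomial.coeff_sum]
    have hconst : g = MvPolynomial.C (g.coeff 0) := by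
      ext m
      rw [MvPolynomial.coeff_C]
      split_ifs with hm
      · rw [hm]
      · by_cases hmd : ∀ j, m j ≤ d
        · obtain ⟨e, rfl⟩ := exists_boxExponent_eq hmd
          have he : e ≠ 0 := by
            rintro rfl
            exact hm (Finsupp.ext fun _ => rfl)
          rw [hcoeff]
          exact congrFun hy ⟨e, he⟩
        · push Not at hmd
          obtain ⟨j, hj⟩ := hmd
          rw [hcoeff]
          refine Finset.sum_eq_zero fun i _ => ?_
          rw [MvPolynomial.notMem_support_iff.1, mul_zero]
          intro hmem
          exact absurd (MvPolynomial.degreeOf_le_iff.1 (degreeOf_le_maxPartialDegree f i j) m hmem)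
            (by omega)
    have hrel : ∑ i, (Fin.cons (-g.coeff 0) y : Fin (r + 1) → ℚ_[p]) i •
        (Fin.cons 1 f : Fin (r + 1) → MvPolynomial (Fin n) ℚ_[p]) i = 0 := by
      rw [Fin.sum_univ_succ]
      simp only [Fin.cons_zero, Fin.cons_succ]
      rw [← hg]
      conv_lhs => rw [hconst]
      rw [MvPolynomial.coeff_C, if_pos rfl, neg_smul, MvPolynomial.smul_eq_C_mul, mul_one,
        neg_add_cancel]
    ext i
    simpa using Fintype.linearIndependent_iff.1 hf _ hrel i.succ
  obtain ⟨K, hK, hT⟩ := T.exists_antilipschitzWith hker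
  refine ⟨max 1 (K : ℝ), le_max_left _ _, fun y hy => ?_⟩
  have h1 : ‖y‖ ≤ K * ‖T y‖ := by simpa using hT.le_mul_dist y 0
  have h2 : 0 < ‖T y‖ := by
    rw [norm_pos_iff]
    intro h
    rw [h, norm_zero, mul_zero] at h1
    exact hy (norm_le_zero_iff.1 h1)
  obtain ⟨e, he⟩ : ∃ e, ‖T y‖ ≤ ‖T y e‖ := by
    by_contra! h
    exact lt_irrefl _ ((pi_norm_lt_iff h2).2 h)
  refine ⟨e.1, e.2, h1.trans ?_⟩
  have : T y e = ∑ i, y i * (f i).coeff (boxExponent e.1) := rfl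
  rw [← this]
  gcongr
  exact le_max_right _ _

/-- A Lebesgue number of the cover of the support by fibres makes local constancy uniform there. Two
points that close and both off the support have value `0`; if one is in the support, the argument
applies from it. -/
lemma IsSchwartzBruhat.exists_bounds {n : ℕ} {φ : (Fin n → ℚ_[p]) → ℚ}
    (hφ : IsSchwartzBruhat φ) : ∃ (Φ R : ℝ) (N : ℕ), 0 ≤ Φ ∧ 1 ≤ R ∧ (∀ x, ‖(φ x : ℂ)‖ ≤ Φ) ∧
      (∀ x, φ x ≠ 0 → ‖x‖ ≤ R) ∧ BallInvariant φ ((p : ℝ) ^ N)⁻¹ := by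
  obtain ⟨hloc, hcomp⟩ := hφ
  have hp1 : (1 : ℝ) < p := by exact_mod_cast (Fact.out : p.Prime).one_lt
  have hsub : ∀ x, φ x ≠ 0 → x ∈ tsupport φ := fun x hx => subset_tsupport φ hx
  obtain ⟨Φ, hΦ⟩ := ((hloc.comp fun q : ℚ => (q : ℂ)).continuous).bounded_above_of_compact_support
    (hcomp.comp_left (g := fun q : ℚ => (q : ℂ)) (by simp))
  obtain ⟨R, hR⟩ := hcomp.isCompact.isBounded.exists_norm_le
  obtain ⟨δ, hδ, hball⟩ := lebesgue_number_lemma_of_metric (c := fun q : ℚ => φ ⁻¹' {q})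
    hcomp.isCompact (fun q => hloc.isOpen_fiber q) (fun x _ => Set.mem_iUnion.2 ⟨φ x, rfl⟩)
  obtain ⟨N, hN⟩ := exists_pow_lt_of_lt_one hδ (inv_lt_one_of_one_lt₀ hp1)
  rw [inv_pow] at hN
  have hconst : ∀ x ∈ tsupport φ, ∀ z, ‖z - x‖ < δ → φ z = φ x := by
    intro x hx z hz
    obtain ⟨q, hq⟩ := hball x hx
    have h1 : φ x = q := hq (Metric.mem_ball_self hδ)
    have h2 : φ z = q := hq (by rwa [Metric.mem_ball, dist_eq_norm])
    rw [h1, h2]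
  refine ⟨max 0 Φ, max 1 R, N, le_max_left _ _, le_max_left _ _,
    fun x => (hΦ x).trans (le_max_right _ _),
    fun x hx => (hR x (hsub x hx)).trans (le_max_right _ _), fun x u hu => ?_⟩
  have hu' := hu.trans_lt hN
  by_cases hx : x ∈ tsupport φ
  · exact hconst x hx _ (by rwa [add_sub_cancel_left])
  by_cases hxu : x + u ∈ tsupport φ
  · exact (hconst _ hxu x (by rwa [sub_add_cancel_left, norm_neg])).symm
  · rw [image_eq_zero_of_notMem_tsupport hx, image_eq_zero_of_notMem_tsupport hxu]

lemma integral_haarPi_eq {n : ℕ} {R : ℝ} {F : (Fin n → ℚ_[p]) → ℂ}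
    (hF : ∀ x, F x ≠ 0 → ‖x‖ ≤ R) :
    ∫ x, F x ∂(haarPi p n) = ∫ x, F x ∂(haarBox p n R) := by
  have h : haarBox p n R =
      (haarPi p n).restrict (Set.univ.pi fun _ => Metric.closedBall 0 R) := by
    rw [haarPi, Measure.restrict_pi_pi]; rfl
  rw [h, setIntegral_eq_integral_of_forall_compl_eq_zero]
  intro x hx
  by_contra h0
  refine hx fun i _ => ?_
  rw [mem_closedBall_zero_iff]
  exact (norm_le_pi_norm x i).trans (hF x h0)

lemma expIntegral_eq_boxEval {n r : ℕ} (ψ : AddChar ℚ_[p] Circle) (φ : (Fin n → ℚ_[p]) → ℚ)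
    (f : Fin r → MvPolynomial (Fin n) ℚ_[p]) (y : Fin r → ℚ_[p]) {R : ℝ}
    (hφ : ∀ x, φ x ≠ 0 → ‖x‖ ≤ R) :
    expIntegral ψ φ f y = ∫ x, (φ x : ℂ) * (ψ (boxEval (fun e : Fin n →
      Fin (maxPartialDegree f + 1) => ∑ i, y i * (f i).coeff (boxExponent e)) x) : ℂ)
        ∂(haarBox p n R) := by
  rw [← integral_haarPi_eq]
  · simp only [← boxEval_sum, ← eval_eq_boxEval (degreeOf_le_maxPartialDegree f _)]
    rfl
  · intro x hx
    exact hφ x fun h => hx (by simp [h])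

/-! ### The decay bound and valuations -/

/-- The logarithmic decay bound for `‖y‖ = p ^ L` with `L ≥ 1`. -/
lemma exists_norm_expIntegral_le {n r : ℕ} {ψ : AddChar ℚ_[p] Circle} (hψ : Continuous ψ)
    (hψ1 : ψ ≠ 1) {f : Fin r → MvPolynomial (Fin n) ℚ_[p]}
    (hf : LinearIndependent ℚ_[p] (Fin.cons 1 f : Fin (r + 1) → MvPolynomial (Fin n) ℚ_[p]))
    {φ : (Fin n → ℚ_[p]) → ℚ} (hφ : IsSchwartzBruhat φ) :
    ∃ C : ℝ, 0 ≤ C ∧ ∀ (y : Fin r → ℚ_[p]) (L : ℕ), 1 ≤ L → ‖y‖ = (p : ℝ) ^ L →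
      ‖expIntegral ψ φ f y‖ ≤
        C * (L : ℝ) ^ (n - 1) * ‖y‖ ^ (-(1 / (maxPartialDegree f : ℝ))) := by
  have hp1 : (1 : ℝ) ≤ p := by exact_mod_cast (Fact.out : p.Prime).one_le
  obtain ⟨B, hB, hcoeff⟩ := exists_le_norm_coeff hf
  have hy0 : ∀ (y : Fin r → ℚ_[p]) (L : ℕ), ‖y‖ = (p : ℝ) ^ L → y ≠ 0 := by
    rintro y L hy rfl
    rw [norm_zero] at hy
    have : (0 : ℝ) < (p : ℝ) ^ L := by positivity
    linarith
  rcases n with _ | n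
  -- With no variables there is no nonzero exponent, so no nonzero `y` exists; the same happens
  -- below when `d = 0`.
  · refine ⟨0, le_rfl, fun y L _ hy => ?_⟩
    obtain ⟨e, he, -⟩ := hcoeff y (hy0 y L hy)
    exact (he (Subsingleton.elim _ _)).elim
  set d := maxPartialDegree f with hd
  rcases eq_or_ne d 0 with hd0 | hd0
  · refine ⟨0, le_rfl, fun y L _ hy => ?_⟩
    obtain ⟨e, he, -⟩ := hcoeff y (hy0 y L hy)
    refine (he (funext fun i => Fin.ext ?_)).elim
    have := (e i).isLt
    simp only [Pi.zero_apply, Fin.val_zero]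
    omega
  obtain ⟨Φ, R, N, hΦ, hR, hbd, hsupp, hinv⟩ := hφ.exists_bounds
  obtain ⟨C, hC, hmain⟩ := norm_integral_boxEval_le hψ hψ1 hd0 hR hΦ N n
  refine ⟨C * 2 ^ n * B, by positivity, fun y L hL hy => ?_⟩
  obtain ⟨e, he, hye⟩ := hcoeff y (hy0 y L hy)
  have h1 := hmain (fun x => (φ x : ℂ)) hbd (fun x u hu => congrArg _ (hinv x u hu))
    (fun x hx => hsupp x fun h => hx (by simp [h]))
    (fun e => ∑ i, y i * (f i).coeff (boxExponent e)) e he L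
  rw [← expIntegral_eq_boxEval ψ φ f y hsupp] at h1
  have h2 : decayWeight p d L ‖∑ i, y i * (f i).coeff (boxExponent e)‖ ≤
      B * decayWeight p d L ‖y‖ :=
    decayWeight_le_mul hd0 hB (hye.trans (by gcongr; exact le_self_pow₀ hB hd0))
  -- Truncating at `p^L = |y|` loses nothing at `|y|` itself.
  have h3 : decayWeight p d L ‖y‖ = ‖y‖ ^ (-(1 / (d : ℝ))) := by
    rw [decayWeight, hy, min_self, max_eq_right (one_le_pow₀ hp1)]
  have h4 : ((L : ℝ) + 1) ^ n ≤ 2 ^ n * (L : ℝ) ^ n := by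
    rw [← mul_pow]
    have : (1 : ℝ) ≤ L := by exact_mod_cast hL
    gcongr; linarith
  rw [h3] at h2
  have h5 := (decayWeight_pos p d L
    ‖∑ i, y i * (f i).coeff (boxExponent e)‖).le
  rw [Nat.add_sub_cancel]
  calc _ ≤ _ := h1
    _ ≤ C * (2 ^ n * (L : ℝ) ^ n) * (B * ‖y‖ ^ (-(1 / (d : ℝ)))) := by gcongr
    _ = _ := by ring

lemma exists_norm_expIntegral_le_const {n r : ℕ} (ψ : AddChar ℚ_[p] Circle)
    (f : Fin r → MvPolynomial (Fin n) ℚ_[p]) (φ : (Fin n → ℚ_[p]) → ℚ) :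
    ∃ B : ℝ, 0 ≤ B ∧ ∀ y : Fin r → ℚ_[p], ‖expIntegral ψ φ f y‖ ≤ B := by
  refine ⟨∫ x, ‖(φ x : ℂ)‖ ∂(haarPi p n), integral_nonneg fun _ => norm_nonneg _, fun y => ?_⟩
  refine (norm_integral_le_integral_norm _).trans_eq ?_
  simp only [norm_mul, Circle.norm_coe, mul_one]

lemma norm_eq_pow_of_tupleValuation_eq {r : ℕ} {y : Fin r → ℚ_[p]} {m : ℤ}
    (h : tupleValuation y = (m : WithTop ℤ)) : ‖y‖ = (p : ℝ) ^ (-m) := by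
  have hp1 : (1 : ℝ) ≤ p := by exact_mod_cast (Fact.out : p.Prime).one_le
  have hr : (Finset.univ : Finset (Fin r)).Nonempty := by
    by_contra hne
    rw [Finset.not_nonempty_iff_eq_empty] at hne
    rw [tupleValuation, hne, Finset.inf_empty] at h
    exact WithTop.top_ne_coe h
  refine le_antisymm ((pi_norm_le_iff_of_nonneg (by positivity)).2 fun i => ?_) ?_
  · by_cases hi : y i = 0
    · rw [hi, norm_zero]; positivity
    · have h1 : tupleValuation y ≤ Padic.addValuation (y i) := Finset.inf_le (Finset.mem_univ i)
      rw [h, Padic.addValuation.apply hi, WithTop.coe_le_coe] at h1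
      rw [Padic.norm_eq_zpow_neg_valuation hi]
      exact zpow_le_zpow_right₀ hp1 (by omega)
  · obtain ⟨i, -, hi⟩ := Finset.exists_mem_eq_inf _ hr fun i => Padic.addValuation (y i)
    have h1 : Padic.addValuation (y i) = (m : WithTop ℤ) := by rw [← hi]; exact h
    have hi0 : y i ≠ 0 := by
      intro h0
      rw [h0, AddValuation.map_zero] at h1
      exact WithTop.top_ne_coe h1
    rw [Padic.addValuation.apply hi0, WithTop.coe_inj] at h1
    rw [← h1, ← Padic.norm_eq_zpow_neg_valuation hi0]
    exact norm_le_pi_norm y i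

lemma exists_norm_eq_pow {r : ℕ} {y : Fin r → ℚ_[p]} (hy : 1 < ‖y‖) :
    ∃ L : ℕ, 1 ≤ L ∧ ‖y‖ = (p : ℝ) ^ L := by
  have hp1 : (1 : ℝ) < p := by exact_mod_cast (Fact.out : p.Prime).one_lt
  obtain ⟨i, hi⟩ : ∃ i, ‖y‖ ≤ ‖y i‖ := by
    by_contra! h
    exact lt_irrefl _ ((pi_norm_lt_iff (by linarith)).2 h)
  have hyi : ‖y‖ = ‖y i‖ := le_antisymm hi (norm_le_pi_norm y i)
  have hi0 : y i ≠ 0 := by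
    rw [← norm_pos_iff, ← hyi]; linarith
  rw [hyi, Padic.norm_eq_zpow_neg_valuation hi0] at hy ⊢
  have hv : 0 < -(y i).valuation := by
    by_contra! h
    exact absurd (zpow_le_one_of_nonpos₀ hp1.le h) (not_le.2 hy)
  obtain ⟨L, hL⟩ := Int.eq_ofNat_of_zero_le hv.le
  exact ⟨L, by omega, by rw [hL, zpow_natCast]⟩

end PadicExp

end

theorem mainTheorem6 (p : ℕ) [Fact p.Prime] (n r : ℕ)
    (ψ : AddChar ℚ_[p] Circle) (hψ_cont : Continuous ψ) (hψ : ψ ≠ 1)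
    (f : Fin r → MvPolynomial (Fin n) ℚ_[p])
    (hf : LinearIndependent ℚ_[p]
      (Fin.cons 1 f : Fin (r + 1) → MvPolynomial (Fin n) ℚ_[p]))
    (φ : (Fin n → ℚ_[p]) → ℚ) (hφ : PadicExp.IsSchwartzBruhat φ) :
    (∀ ε : ℝ, 0 < ε → ε ≤ 1 / (PadicExp.maxPartialDegree f : ℝ) →
      ∃ c : ℝ,
        (∀ y : Fin r → ℚ_[p], y ≠ 0 →
          ‖PadicExp.expIntegral ψ φ f y‖ ≤
            c * min (‖y‖ ^ (ε - 1 / (PadicExp.maxPartialDegree f : ℝ))) 1) ∧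
        ‖PadicExp.expIntegral ψ φ f 0‖ ≤ c) ∧
    (∃ c : ℝ, ∀ (y : Fin r → ℚ_[p]) (m : ℤ), PadicExp.tupleValuation y = (m : WithTop ℤ) →
      m < 0 →
        ‖PadicExp.expIntegral ψ φ f y‖ ≤
          c * (-(m : ℝ)) ^ (n - 1) * ‖y‖ ^ (-(1 / (PadicExp.maxPartialDegree f : ℝ)))) := by
  have hp1 : (1 : ℝ) < p := by exact_mod_cast (Fact.out : p.Prime).one_lt
  obtain ⟨C, hC, hlog⟩ := PadicExp.exists_norm_expIntegral_le hψ_cont hψ hf hφ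
  obtain ⟨B, hB, hconst⟩ := PadicExp.exists_norm_expIntegral_le_const ψ f φ
  refine ⟨fun ε hε hε1 => ?_, C, fun y m hm hm0 => ?_⟩
  · have hpε : 1 < (p : ℝ) ^ ε := Real.one_lt_rpow hp1 hε
    -- The logarithmic factor `L^(n-1)` is absorbed by `p^(ε L) = |y|^ε`.
    obtain ⟨D, hD⟩ := (tendsto_pow_const_div_const_pow_of_one_lt (n - 1) hpε).bddAbove_range
    have hD' : ∀ L : ℕ, (L : ℝ) ^ (n - 1) ≤ D * ((p : ℝ) ^ ε) ^ L := fun L => by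
      rw [← div_le_iff₀ (by positivity)]
      exact hD ⟨L, rfl⟩
    refine ⟨max B (C * D), fun y hy => ?_, (hconst 0).trans (le_max_left _ _)⟩
    have hy0 : 0 < ‖y‖ := norm_pos_iff.2 hy
    rcases le_or_gt ‖y‖ 1 with hy1 | hy1
    · rw [min_eq_right (Real.one_le_rpow_of_pos_of_le_one_of_nonpos hy0 hy1 (by linarith)), mul_one]
      exact (hconst y).trans (le_max_left _ _)
    · rw [min_eq_left (Real.rpow_le_one_of_one_le_of_nonpos hy1.le (by linarith))]
      obtain ⟨L, hL, hyL⟩ := PadicExp.exists_norm_eq_pow hy1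
      have hpow : ((p : ℝ) ^ ε) ^ L = ‖y‖ ^ ε := by
        rw [hyL, ← Real.rpow_natCast, ← Real.rpow_mul (by linarith), mul_comm, Real.rpow_mul
          (by linarith), Real.rpow_natCast]
      calc _ ≤ _ := hlog y L hL hyL
        _ ≤ C * (D * ‖y‖ ^ ε) * ‖y‖ ^ (-(1 / (PadicExp.maxPartialDegree f : ℝ))) := by
            gcongr; rw [← hpow]; exact hD' L
        _ = C * D * ‖y‖ ^ (ε - 1 / (PadicExp.maxPartialDegree f : ℝ)) := by
            rw [sub_eq_add_neg, Real.rpow_add hy0]; ring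
        _ ≤ _ := by gcongr; exact le_max_right _ _
  · obtain ⟨L, hL⟩ := Int.eq_ofNat_of_zero_le (by omega : 0 ≤ -m)
    have hmL : -(m : ℝ) = (L : ℝ) := by exact_mod_cast hL
    rw [hmL]
    refine hlog y L (by omega) ?_
    rw [PadicExp.norm_eq_pow_of_tupleValuation_eq hm, hL, zpow_natCast]
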